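/- **Setting.** A stochastic combinatorial partial monitoring game is played as follows. The learner has an action set $\mathcal X$; each action $x$ has a matrix $M_x\in\mathbb R^{m_x\times n}$ and a reward function $r(x,\cdot)$. In every round $t$ the adversary draws $\theta(t)\in[0,1]^n$ i.i.d. from a fixed distribution $p$ with mean $\theta^*$; the learner plays $x(t)$, earns $r(x(t),\theta(t))$ and observes only $M_{x(t)}\theta(t)$. Assume: (1) $\mathbb E_{\theta\sim p}[r(x,\theta)]=\bar r(x,\theta^*)$ for all $x$, for a function $\bar r:\mathcal X\times\mathbb R^n\to\mathbb R$; (2) $\sigma=\{x_1,\dots,x_{|\sigma|}\}\subseteq\mathcal X$ is a global observable set, i.e. the matrix $M_\sigma$ obtained by stacking $M_{x_1},\dots,M_{x_{|\sigma|}}$ has rank $n$; $M_\sigma^+=(M_\sigma^\top M_\sigma)^{-1}M_\sigma^\top$; (3) $|\bar r(x,\theta_1)-\bar r(x,\theta_2)|\le R\|\theta_1-\theta_2\|_2$ for all $x,\theta_1,\theta_2$, where $R>0$. The learner has an oracle returning a maximizer of $\bar r(\cdot,\theta)$ for every $\theta\in\mathbb R^n$ (and the second best value). Put $$\beta_\sigma=\sqrt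 n\sum_{k=1}^{|\sigma|}\big\|(M_\sigma^\top M_\sigma)^{-1}M_{x_k}^\top M_{x_k}\big\|_2,\quad R_{\max}=\max_{x\in\mathcal X,\,\theta\in[0,1]^n}\bar r(x,\theta),\quad \Delta_x=\max_{y}\bar r(y,\theta^*)-\bar r(x,\theta^*),\quad \Delta=\inf\{\Delta_x:\Delta_x>0\},$$ and assume that the expected regret of a round is at most $R_{\max}$, i.e. $\Delta_x\le R_{\max}$ for all $x$ (automatic if $\bar r\ge0$ on $\mathcal X\times[0,1]^n$). The expected regret is $R(T)=T\max_x\mathbb E[r(x,\theta)]-\sum_{t=1}^T\mathbb E[r(x(t),\theta(t))]$, the rewards $r(x(t),\theta(t))$ being assumed integrable. A *block* consists of playing $x_1,\dots,x_{|\sigma|}$ once each, at times $t_1,\dots,t_{|\sigma|}$; its estimate is $\tilde\theta=M_\sigma^+(M_{x_1}\theta(t_1),\dots,M_{x_{|\sigma|}}\theta(t_{|\sigma|}))$. **Algorithm PEGE2** with horizon $T$. Let $$T_0=\Big(\frac{2R\beta_\sigma T}{|\sigma|R_{\max}}\Big)^{2/3},\qquad \delta=\frac1T,\qquad w(b)=\sqrt{\frac{R^2\beta_\sigma^2\log(4e^2b^2/\delta)}{b}}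 .$$ *Gap estimation.* For $b=1,2,\dots$: play a block, and let $\hat\theta(b)$ be the average of the $b$ block estimates so far. If $\bar r(\cdot,\hat\theta(b))$ has a unique maximizer $\hat x(b)$ and $\hat\Delta:=\bar r(\hat x(b),\hat\theta(b))-\sup_{x\ne\hat x(b)}\bar r(x,\hat\theta(b))>6w(b)$, stop and output $\hat\Delta$; otherwise, if $b>T_0$, stop and output "threshold exceeded". *Afterwards.* If the threshold was exceeded, play a maximizer of $\bar r(\cdot,\hat\theta)$, with $\hat\theta$ the latest estimate, in all remaining rounds. Otherwise, in the remaining rounds, run PEGE from scratch with $h=\hat\Delta^2/(9R^2\beta_\sigma^2)$: for $b=1,2,\dots$, play a block, let $\hat\theta(b)$ be the average of the $b$ block estimates of this run, and play a maximizer of $\bar r(\cdot,\hat\theta(b))$ for $\lfloor e^{hb}\rfloor$ rounds. Everything stops after $T$ rounds in total. **Theorem.** Let $T\ge2$ (so that $\delta\in(0,1)$) and $T_0\ge1$. Put $$T_1=\frac{256R^2\beta_\sigma^2}{\Delta^2}\log\frac{512e^2R^2\beta_\sigma^2}{\Delta^2\delta},$$ $$B_1(T)=2\big(2R\beta_\sigma|\sigma|^{1/2}R_{\max}^{1/2}T\big)^{2/3}\sqrt{\log(4e^2T^3)}+R_{\max},$$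 $$B_2(T)=\max\{T_1,2\}\,R_{\max}|\sigma|+\sum_{x\in\sigma}\Delta_x\frac{36R^2\beta_\sigma^2\log T}{\Delta^2}+\frac{8e^2R^2\beta_\sigma^2}{\Delta^2}+R_{\max}.$$ If the maximizer of $\bar r(\cdot,\theta^*)$ is not unique, then $R(T)\le B_1(T)$. If it is unique and $\Delta>0$ (with at least one suboptimal action, so that $\Delta$ exists), then $R(T)\le B_2(T)$ when $T_1<T_0$, and $R(T)\le C\,T^{2/3}\log T$ when $T_0\le T_1$, where $C$ depends only on $R,\beta_\sigma,|\sigma|,R_{\max}$ (not on $p$, $\Delta$ or $T$). -/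

import Mathlib

open MeasureTheory ProbabilityTheory

noncomputable section

/-- `ℝⁿ` with the Euclidean norm. -/
abbrev Vec (n : ℕ) : Type := EuclideanSpace ℝ (Fin n)

/-- The adversary's action set `[0,1]ⁿ`. -/
def cube (n : ℕ) : Set (Vec n) := {θ | ∀ i, 0 ≤ θ i ∧ θ i ≤ 1}

/-- A stochastic combinatorial partial monitoring game with learner's action set `X` and adversary's
action set `[0,1]ⁿ`, together with a global observable set `σ = {x₁, …, x_s}`, under the three
standing assumptions: the expected reward is a function `rbar` of the action and of the mean of the
adversary's distribution; the stacked matrices of `σ` have full column rank; `rbar` is Lipschitz in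
its second argument. -/
structure CPMGame (n : ℕ) (X : Type*) [MeasurableSpace X] where
  /-- number of rows of the transformation matrix of an action -/
  m : X → ℕ
  /-- the transformation matrices: playing `x` against `θ` yields the feedback `M x * θ` -/
  M : (x : X) → Matrix (Fin (m x)) (Fin n) ℝ
  /-- the reward function -/
  r : X → Vec n → ℝ
  measurable_r : Measurable (Function.uncurry r)
  /-- the adversary's strategy: a probability distribution on `[0,1]ⁿ` -/
  p : Measure (Vec n)
  prob_p : IsProbabilityMeasure p
  p_cube : ∀ᵐ θ ∂p, θ ∈ cube n
  /-- the expected reward, as a function of the action and of a mean vector -/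
  rbar : X → Vec n → ℝ
  integrable_r : ∀ x, Integrable (r x) p
  expected_r : ∀ x, ∫ θ, r x θ ∂p = rbar x (∫ θ, θ ∂p)
  /-- size of the global observable set -/
  s : ℕ
  /-- enumeration `x₁, …, x_s` of the global observable set -/
  σ : Fin s → X
  σ_injective : Function.Injective σ
  full_rank :
    (Matrix.of fun (q : Σ k : Fin s, Fin (m (σ k))) (j : Fin n) => M (σ q.1) q.2 j).rank = n
  /-- the Lipschitz constant -/
  R : ℝ
  R_pos : 0 < R
  lipschitz : ∀ x θ₁ θ₂, |rbar x θ₁ - rbar x θ₂| ≤ R * ‖θ₁ - θ₂‖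

namespace CPMGame

variable {n : ℕ} {X : Type*} [MeasurableSpace X] (G : CPMGame n X)

/-- The mean `θ*_p` of the adversary's distribution. -/
def mean : Vec n := ∫ θ, θ ∂G.p

/-- The stacked matrix `M_σ`. -/
def stacked : Matrix (Σ k : Fin G.s, Fin (G.m (G.σ k))) (Fin n) ℝ :=
  Matrix.of fun q j => G.M (G.σ q.1) q.2 j

/-- The Moore-Penrose pseudoinverse `(M_σᵀ M_σ)⁻¹ M_σᵀ` of the matrix `M_σ` of full column rank. -/
def pinv : Matrix (Fin n) (Σ k : Fin G.s, Fin (G.m (G.σ k))) ℝ :=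
  (G.stacked.transpose * G.stacked)⁻¹ * G.stacked.transpose

/-- `β_σ = √n ∑ₖ ‖(M_σᵀ M_σ)⁻¹ M_{xₖ}ᵀ M_{xₖ}‖₂`, with the spectral norm. -/
def betaσ : ℝ :=
  Real.sqrt n * ∑ k : Fin G.s,
    ‖Matrix.toEuclideanCLM (n := Fin n) (𝕜 := ℝ)
      ((G.stacked.transpose * G.stacked)⁻¹ * ((G.M (G.σ k)).transpose * G.M (G.σ k)))‖

/-- `R_max`, the maximum of the expected reward over all actions and all `θ ∈ [0,1]ⁿ`. -/
def Rmax : ℝ := sSup {v | ∃ x, ∃ θ ∈ cube n, v = G.rbar x θ}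

/-- `Δ_x`, the difference of the best expected reward and the expected reward of `x`. -/
def gap (x : X) : ℝ := (⨆ y, G.rbar y G.mean) - G.rbar x G.mean

/-- `Δ`, the smallest positive `Δ_x` (the infimum, so that no attainment has to be assumed). -/
def minGap : ℝ := sInf {d | ∃ x, d = G.gap x ∧ 0 < G.gap x}

/-- The optimal action is unique. -/
def UniqueOptimal : Prop := ∃! x, ∀ y, G.rbar y G.mean ≤ G.rbar x G.mean

/-- An argmax oracle: `am θ` maximizes `rbar · θ`, for every `θ ∈ ℝⁿ`. -/
def IsArgmaxOracle (am : Vec n → X) : Prop :=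
  ∀ θ x, G.rbar x θ ≤ G.rbar (am θ) θ

/-! ### Estimation -/

/-- The estimate `M_σ⁺ (M_{x₁} θ(a), …, M_{x_s} θ(a+s-1))` computed from the feedback of one
exploration block, in which `x₁, …, x_s` are played at the times `a, …, a+s-1`. -/
def blockEst (ϑ : ℕ → Vec n) (a : ℕ) : Vec n :=
  WithLp.toLp 2 (G.pinv.mulVec fun q : Σ k : Fin G.s, Fin (G.m (G.σ k)) =>
    (G.M (G.σ q.1)).mulVec (ϑ (a + q.1)).ofLp q.2)

/-- The average `θ̂(b)` of the first `b` block estimates, the `i`-th block starting at `start i`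
(blocks are numbered from `0`). -/
def avgEst (ϑ : ℕ → Vec n) (start : ℕ → ℕ) (b : ℕ) : Vec n :=
  (b : ℝ)⁻¹ • ∑ i ∈ Finset.range b, G.blockEst ϑ (start i)

/-! ### Gap estimation -/

/-- The confidence width `w(b)`. -/
def width (δ : ℝ) (b : ℕ) : ℝ :=
  Real.sqrt (G.R ^ 2 * G.betaσ ^ 2 * Real.log (4 * Real.exp 1 ^ 2 * (b : ℝ) ^ 2 / δ) / b)

/-- The estimated gap at `θ`: the reward of the action `am θ` minus the second best reward, the
maximum (or supremum) over all other actions. -/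
def estGap (am : Vec n → X) (θ : Vec n) : ℝ :=
  G.rbar (am θ) θ - sSup {v | ∃ x, x ≠ am θ ∧ v = G.rbar x θ}

/-- The stopping rule at the end of episode `b`: the maximizer at `θ̂(b)` is unique and the
estimated gap exceeds `6 w(b)`. Episode `b ≥ 1` occupies the times `(b-1)s, …, bs-1`. -/
def GapFound (am : Vec n → X) (δ : ℝ) (ϑ : ℕ → Vec n) (b : ℕ) : Prop :=
  let θ := G.avgEst ϑ (fun i => i * G.s) b
  (∀ x, x ≠ am θ → G.rbar x θ < G.rbar (am θ) θ) ∧ 6 * G.width δ b < G.estGap am θ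

/-- The number of episodes of the gap estimation algorithm with threshold `T₀` and confidence
parameter `δ`: it stops at the first `b ≥ 1` at which a gap is found or `b > T₀`. -/
def gapEpisodes (am : Vec n → X) (T₀ δ : ℝ) (ϑ : ℕ → Vec n) : ℕ :=
  sInf {b : ℕ | 1 ≤ b ∧ (G.GapFound am δ ϑ b ∨ T₀ < b)}

/-! ### PEGE with `C(a) = h a`, `α = 1`, `β = 0`, started at time `a₀` -/

/-- Starting time of phase `j` (phases numbered from `0`): phase `j` consists of `s` exploration
rounds followed by `⌊exp (h (j+1))⌋` exploitation rounds. -/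
def phaseStart (h : ℝ) (a₀ j : ℕ) : ℕ :=
  a₀ + ∑ i ∈ Finset.range j, (G.s + ⌊Real.exp (h * ((i : ℝ) + 1))⌋₊)

/-- The phase (numbered from `0`) to which the time `t ≥ a₀` belongs. -/
def phaseIndex (h : ℝ) (a₀ t : ℕ) : ℕ := sInf {j | t < G.phaseStart h a₀ (j + 1)}

/-- The action that PEGE, started at time `a₀`, plays at time `t ≥ a₀`. -/
def pegeAction (am : Vec n → X) (h : ℝ) (a₀ : ℕ) (ϑ : ℕ → Vec n) (t : ℕ) : X :=
  let j := G.phaseIndex h a₀ t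
  if ho : t - G.phaseStart h a₀ j < G.s then G.σ ⟨t - G.phaseStart h a₀ j, ho⟩
  else am (G.avgEst ϑ (G.phaseStart h a₀) (j + 1))

/-! ### PEGE2 -/

/-- The exploration threshold `T₀`. -/
def T₀ (T : ℕ) : ℝ := (2 * G.R * G.betaσ * T / (G.s * G.Rmax)) ^ (2 / 3 : ℝ)

/-- The action that PEGE2 with horizon `T` plays at time `t` (times are numbered from `0`) when the
adversary's moves are `ϑ 0, ϑ 1, …`. -/
def pege2Action (am : Vec n → X) (T : ℕ) (ϑ : ℕ → Vec n) (t : ℕ) : X :=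
  let N := G.gapEpisodes am (G.T₀ T) (1 / T) ϑ
  let θ := G.avgEst ϑ (fun i => i * G.s) N
  open scoped Classical in
  if ht : t < N * G.s then
    G.σ ⟨t % G.s, Nat.mod_lt _ (Nat.pos_of_mul_pos_left (Nat.zero_lt_of_lt ht))⟩
  else if G.GapFound am (1 / T) ϑ N then
    G.pegeAction am (G.estGap am θ ^ 2 / (9 * G.R ^ 2 * G.betaσ ^ 2)) (N * G.s) ϑ t
  else am θ

/-- The expected regret `R(T)` of PEGE2 with horizon `T`, when the adversary's moves are the random
vectors `θ 0, θ 1, …`. -/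
def regret (am : Vec n → X) {Ω : Type*} [MeasurableSpace Ω] (P : Measure Ω)
    (θ : ℕ → Ω → Vec n) (T : ℕ) : ℝ :=
  T * (⨆ x, ∫ v, G.r x v ∂G.p) -
    ∑ t ∈ Finset.range T, ∫ ω, G.r (G.pege2Action am T (fun i => θ i ω) t) (θ t ω) ∂P

/-! ### The bounds -/

/-- `T₁(δ)`. -/
def T₁ (δ : ℝ) : ℝ :=
  256 * G.R ^ 2 * G.betaσ ^ 2 / G.minGap ^ 2 *
    Real.log (512 * Real.exp 1 ^ 2 * G.R ^ 2 * G.betaσ ^ 2 / (G.minGap ^ 2 * δ))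

/-- The distribution independent bound. -/
def B₁ (T : ℕ) : ℝ :=
  2 * (2 * G.R * G.betaσ * (G.s : ℝ) ^ (1 / 2 : ℝ) * G.Rmax ^ (1 / 2 : ℝ) * T) ^ (2 / 3 : ℝ) *
    Real.sqrt (Real.log (4 * Real.exp 1 ^ 2 * (T : ℝ) ^ 3)) + G.Rmax

/-- The distribution dependent bound. -/
def B₂ (T : ℕ) : ℝ :=
  max (G.T₁ (1 / T)) 2 * G.Rmax * G.s
    + ∑ k : Fin G.s, G.gap (G.σ k) * (36 * G.R ^ 2 * G.betaσ ^ 2 * Real.log T / G.minGap ^ 2)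
    + 8 * Real.exp 1 ^ 2 * G.R ^ 2 * G.betaσ ^ 2 / G.minGap ^ 2
    + G.Rmax

end CPMGame

end

/-! Every rate comes from one concentration bound. The maps `blockMap k` sum to the identity, so the
average of `b` block estimates minus the mean is an average of independent centred vectors, each
lying in a ball of radius `‖blockMap k‖ √n / 2`. A Hoeffding inequality in Hilbert space
(`measure_norm_sum_ge_le`), proved by controlling E cosh‖·‖, gives a reward error above γ with
probability at most 2 exp(-2bγ²/(R²β²)) (`measure_avgEst_ge_le`). For γ = w(b) these probabilities
sum to at most 1/(32T), so the event that some error reaches its width costs at most R_max/32.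

Off that event gap estimation is controlled deterministically. With several optimal actions the
estimated gap stays below 2w, so the test against 6w never succeeds. With a unique one it lies
within 2w of Δ. Success then forces 4w < Δ and D/16 ≤ h ≤ D/4, where D = Δ²/(R²β²)
(`pegeParam_bounds`), and 8w ≤ Δ forces success. Without success, exploration takes at most 2T₀
blocks and each later round loses at most 2w; T₀ balances the two (`T₀_mul_sqrt`, `not_found_le`).

In the b-th phase of PEGE the exploited action is suboptimal with probability at most 2 exp(-Db/2),
while the exploitation lasts at most exp(hb) ≤ exp(Db/4) rounds; summing gives 8R_max/D. The number
of phases is at most 1 + log T / h (`lintegral_pege_le`). Although h is random, it depends only on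
outcomes that precede PEGE, and PEGE uses only fresh ones, so h can be frozen by Fubini
(`lintegral_foundSet_le`).

`regret_le_of_parts` adds these costs. For B₂, `exists_episodes` supplies a b with 8w(b) ≤ Δ, far
enough below T₁ to absorb 8R_max/D, one extra block and R_max/32. For the T^(2/3) log T bound,
success within 2T₀ episodes certifies, through 4w < Δ, that log T / D is O(T₀), so PEGE costs no
more than the order of the exploration. -/

section Hoeffding

/-! ### A dimension-free Hoeffding inequality in Hilbert spaces -/

/-- Convexity of `y ↦ cosh √y`. -/
theorem cosh_le_of_sq_le_convex_comb {r a b p : ℝ} (hp0 : 0 ≤ p) (hp1 : p ≤ 1)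
    (h : r ^ 2 ≤ p * a ^ 2 + (1 - p) * b ^ 2) :
    Real.cosh r ≤ p * Real.cosh a + (1 - p) * Real.cosh b := by
  -- Both sides are power series in the squared arguments with nonnegative coefficients, so
  -- convexity of y ↦ yᵏ on [0, ∞) can be used term by term.
  refine hasSum_le (fun k => ?_) (Real.hasSum_cosh r)
    (((Real.hasSum_cosh a).mul_left p).add ((Real.hasSum_cosh b).mul_left (1 - p)))
  have h1 : (r ^ 2) ^ k ≤ (p * a ^ 2 + (1 - p) * b ^ 2) ^ k :=
    pow_le_pow_left₀ (sq_nonneg r) h k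
  have h2 := (convexOn_pow k).2 (Set.mem_Ici.2 (sq_nonneg a)) (Set.mem_Ici.2 (sq_nonneg b)) hp0
    (sub_nonneg.2 hp1) (by ring)
  simp only [smul_eq_mul] at h2
  have h3 : r ^ (2 * k) ≤ p * a ^ (2 * k) + (1 - p) * b ^ (2 * k) := by
    rw [pow_mul, pow_mul, pow_mul]; exact h1.trans h2
  have h4 : (0 : ℝ) < (2 * k).factorial := by positivity
  rw [← mul_div_assoc, ← mul_div_assoc, ← add_div]
  exact div_le_div_of_nonneg_right h3 h4.le

/-- Hoeffding's lemma for a two-point distribution. -/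
theorem two_point_exp_le {p : ℝ} (hp0 : 0 ≤ p) (hp1 : p ≤ 1) (ρ : ℝ) :
    p * Real.exp ρ + (1 - p) * Real.exp (-ρ) ≤ Real.exp ((2 * p - 1) * ρ + ρ ^ 2 / 2) := by
  wlog hρ : 0 ≤ ρ generalizing p ρ
  · have := this (p := 1 - p) (by linarith) (by linarith) (-ρ) (by linarith)
    rw [neg_neg] at this
    convert this using 1
    · ring
    · congr 1; ring
  -- The two-point law is realised on `Bool`, where the scalar Hoeffding lemma for variables in [-ρ,
  -- ρ] applies.
  let μ : Measure Bool :=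
    ENNReal.ofReal p • Measure.dirac true + ENNReal.ofReal (1 - p) • Measure.dirac false
  have hμ : IsProbabilityMeasure μ := ⟨by
    simp only [μ, Measure.add_apply, Measure.smul_apply, measure_univ, smul_eq_mul, mul_one]
    rw [← ENNReal.ofReal_add hp0 (by linarith)]; simp⟩
  have hint : ∀ f : Bool → ℝ, ∫ b, f b ∂μ = p * f true + (1 - p) * f false := by
    intro f
    simp only [μ]
    rw [integral_add_measure (Integrable.of_finite.smul_measure ENNReal.ofReal_ne_top)
      (Integrable.of_finite.smul_measure ENNReal.ofReal_ne_top), integral_smul_measure, integral_smul_measure]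
    simp [ENNReal.toReal_ofReal hp0, ENNReal.toReal_ofReal (sub_nonneg.2 hp1)]
  let Y : Bool → ℝ := fun b => if b then ρ else -ρ
  have h := hasSubgaussianMGF_of_mem_Icc (μ := μ) (X := Y) (a := -ρ) (b := ρ)
    (measurable_of_countable _).aemeasurable
    (ae_of_all _ fun b => by cases b <;> simp [Y, hρ])
  have h1 := h.mgf_le 1
  have hc : (((‖ρ - -ρ‖₊ / 2) ^ 2 : NNReal) : ℝ) = ρ ^ 2 := by
    push_cast
    rw [Real.norm_eq_abs, sub_neg_eq_add, abs_of_nonneg (by linarith)]; ring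
  rw [mgf, hint, hint, hc] at h1
  simp only [Y, if_true, one_mul, Bool.false_eq_true, if_false, one_pow, mul_one] at h1
  have e1 : Real.exp (ρ - (p * ρ + (1 - p) * -ρ)) =
      Real.exp ρ * Real.exp (-((2 * p - 1) * ρ)) := by rw [← Real.exp_add]; congr 1; ring
  have e2 : Real.exp (-ρ - (p * ρ + (1 - p) * -ρ)) =
      Real.exp (-ρ) * Real.exp (-((2 * p - 1) * ρ)) := by rw [← Real.exp_add]; congr 1; ring
  rw [e1, e2] at h1
  have h2 := mul_le_mul_of_nonneg_right h1 (Real.exp_pos ((2 * p - 1) * ρ)).le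
  have e3 : Real.exp (-((2 * p - 1) * ρ)) * Real.exp ((2 * p - 1) * ρ) = 1 := by
    rw [← Real.exp_add]; simp
  calc p * Real.exp ρ + (1 - p) * Real.exp (-ρ)
      = (p * (Real.exp ρ * Real.exp (-((2 * p - 1) * ρ))) +
          (1 - p) * (Real.exp (-ρ) * Real.exp (-((2 * p - 1) * ρ)))) *
          Real.exp ((2 * p - 1) * ρ) := by
        linear_combination -(p * Real.exp ρ + (1 - p) * Real.exp (-ρ)) * e3
    _ ≤ _ := h2
    _ = _ := by rw [← Real.exp_add]; congr 1; ring

/-- Split cosh into its two exponentials and use the two-point bound at ρ and at -ρ, with weights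
exp m and exp (-m). -/
theorem two_point_cosh_le {p : ℝ} (hp0 : 0 ≤ p) (hp1 : p ≤ 1) (m ρ : ℝ) :
    p * Real.cosh (m + ρ) + (1 - p) * Real.cosh (m - ρ) ≤
      Real.exp (ρ ^ 2 / 2) * Real.cosh (m + (2 * p - 1) * ρ) := by
  have h1 := two_point_exp_le hp0 hp1 ρ
  have h2 := two_point_exp_le hp0 hp1 (-ρ)
  have h3 := mul_le_mul_of_nonneg_left h1 (Real.exp_pos m).le
  have h4 := mul_le_mul_of_nonneg_left h2 (Real.exp_pos (-m)).le
  simp only [Real.cosh_eq, neg_add, neg_sub, neg_neg, Real.exp_add, Real.exp_sub, mul_neg,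
    neg_sq] at *
  simp only [Real.exp_neg] at *
  have := Real.exp_pos ρ
  have := Real.exp_pos m
  calc _ = 1 / 2 * (Real.exp m * (p * Real.exp ρ + (1 - p) * (Real.exp ρ)⁻¹) +
        (Real.exp m)⁻¹ * (p * (Real.exp ρ)⁻¹ + (1 - p) * Real.exp ρ)) := by
        field_simp; ring
    _ ≤ _ := by linarith

variable {E : Type*} [NormedAddCommGroup E] [InnerProductSpace ℝ E]

/-- Expanding the square, ‖z + y‖² ≤ ‖z‖² + 2⟨z, y⟩ + ρ², and the right side is the convex
combination of (‖z‖ ± ρ)² with these weights. If ‖z‖ρ = 0 the quotient is 0 by convention, which is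
consistent since the inner product vanishes too. -/
theorem cosh_norm_add_le {z y : E} {ρ : ℝ} (hρ : 0 ≤ ρ) (hy : ‖y‖ ≤ ρ) :
    Real.cosh ‖z + y‖ ≤ (1 + inner ℝ z y / (‖z‖ * ρ)) / 2 * Real.cosh (‖z‖ + ρ) +
      (1 - (1 + inner ℝ z y / (‖z‖ * ρ)) / 2) * Real.cosh (‖z‖ - ρ) := by
  have hv : |inner ℝ z y| ≤ ‖z‖ * ρ :=
    (abs_real_inner_le_norm z y).trans (mul_le_mul_of_nonneg_left hy (norm_nonneg z))
  have hm : 0 ≤ ‖z‖ * ρ := mul_nonneg (norm_nonneg z) hρ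
  have hτ : |inner ℝ z y / (‖z‖ * ρ)| ≤ 1 := by
    rw [abs_div, abs_of_nonneg hm]; exact div_le_one_of_le₀ hv hm
  have hτm : ‖z‖ * ρ * (inner ℝ z y / (‖z‖ * ρ)) = inner ℝ z y := by
    rcases eq_or_ne (‖z‖ * ρ) 0 with h0 | h0
    · rw [h0] at hv ⊢; rw [zero_mul]; exact (abs_nonpos_iff.1 hv).symm
    · exact mul_div_cancel₀ _ h0
  set τ := inner ℝ z y / (‖z‖ * ρ)
  rw [abs_le] at hτ
  refine cosh_le_of_sq_le_convex_comb (by linarith) (by linarith) ?_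
  rw [@norm_add_sq ℝ]
  simp only [RCLike.re_to_real]
  have : ‖y‖ ^ 2 ≤ ρ ^ 2 := pow_le_pow_left₀ (norm_nonneg y) hy 2
  nlinarith

variable [CompleteSpace E] {Ω : Type*} [MeasurableSpace Ω] {P : Measure Ω} [IsProbabilityMeasure P]

/-- The one-step estimate behind the vector Hoeffding inequality. -/
theorem lintegral_cosh_norm_add_le {Z : Ω → E} (hZ : Integrable Z P) (hZ0 : ∫ ω, Z ω ∂P = 0)
    {c : E} {ρ : ℝ} (hρ : ∀ᵐ ω ∂P, ‖Z ω - c‖ ≤ ρ) (x : E) :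
    ∫⁻ ω, ENNReal.ofReal (Real.cosh ‖x + Z ω‖) ∂P ≤
      ENNReal.ofReal (Real.exp (ρ ^ 2 / 2) * Real.cosh ‖x‖) := by
  have hρ0 : 0 ≤ ρ := by
    obtain ⟨ω, hω⟩ := hρ.exists
    exact (norm_nonneg _).trans hω
  have hY : Integrable (fun ω => Z ω - c) P := hZ.sub (integrable_const c)
  have hYint : ∫ ω, (Z ω - c) ∂P = -c := by
    rw [integral_sub hZ (integrable_const c), hZ0]; simp
  -- Recentring at `c` lets ρ be the radius of a ball around an arbitrary point instead of a bound
  -- on ‖Z‖; this saves a factor 2.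
  set z := x + c with hz
  have hc : ‖c‖ ≤ ρ := by
    have := norm_integral_le_of_norm_le_const hρ
    rw [hYint, norm_neg] at this
    simpa using this
  -- The majorant is affine in the inner product, so its expectation is its value at the mean `-c`
  -- of `Z - c`.
  let κ : ℝ → ℝ := fun v => (1 + v / (‖z‖ * ρ)) / 2 * Real.cosh (‖z‖ + ρ) +
      (1 - (1 + v / (‖z‖ * ρ)) / 2) * Real.cosh (‖z‖ - ρ)
  have hκ : ∀ v, κ v = (Real.cosh (‖z‖ + ρ) / 2 + Real.cosh (‖z‖ - ρ) / 2) +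
      ((Real.cosh (‖z‖ + ρ) - Real.cosh (‖z‖ - ρ)) / 2 / (‖z‖ * ρ)) * v := by
    intro v; simp only [κ]; ring
  have hle : ∀ᵐ ω ∂P, Real.cosh ‖x + Z ω‖ ≤ κ (inner ℝ z (Z ω - c)) := by
    filter_upwards [hρ] with ω hω
    have h := cosh_norm_add_le (z := z) hρ0 hω
    rwa [show z + (Z ω - c) = x + Z ω by rw [hz]; abel] at h
  have hin : Integrable (fun ω => inner ℝ z (Z ω - c)) P := hY.const_inner z
  have hκint : Integrable (fun ω => κ (inner ℝ z (Z ω - c))) P := by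
    simp only [hκ]
    exact (integrable_const _).add (hin.const_mul _)
  have hκval : ∫ ω, κ (inner ℝ z (Z ω - c)) ∂P = κ (inner ℝ z (-c)) := by
    simp only [hκ]
    rw [integral_add (integrable_const _) (hin.const_mul _), integral_const_mul,
      integral_inner hY z, hYint]
    simp
  have hκ0 : ∀ᵐ ω ∂P, 0 ≤ κ (inner ℝ z (Z ω - c)) := by
    filter_upwards [hle] with ω hω
    exact (Real.cosh_pos _).le.trans hω
  calc ∫⁻ ω, ENNReal.ofReal (Real.cosh ‖x + Z ω‖) ∂P
      ≤ ∫⁻ ω, ENNReal.ofReal (κ (inner ℝ z (Z ω - c))) ∂P :=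
        lintegral_mono_ae (hle.mono fun ω h => ENNReal.ofReal_le_ofReal h)
    _ = ENNReal.ofReal (κ (inner ℝ z (-c))) := by
        rw [← ofReal_integral_eq_lintegral_ofReal hκint hκ0, hκval]
    _ ≤ _ := ENNReal.ofReal_le_ofReal ?_
  have hc' : ‖-c‖ ≤ ρ := by rwa [norm_neg]
  have hv : |inner ℝ z (-c)| ≤ ‖z‖ * ‖c‖ := by
    simpa using abs_real_inner_le_norm z (-c)
  have hm : 0 ≤ ‖z‖ * ρ := mul_nonneg (norm_nonneg z) hρ0
  have hv' : |inner ℝ z (-c)| ≤ ‖z‖ * ρ := hv.trans (by gcongr)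
  have hτ : |inner ℝ z (-c) / (‖z‖ * ρ)| ≤ 1 := by
    rw [abs_div, abs_of_nonneg hm]; exact div_le_one_of_le₀ hv' hm
  have hτm : ‖z‖ * ρ * (inner ℝ z (-c) / (‖z‖ * ρ)) = inner ℝ z (-c) := by
    rcases eq_or_ne (‖z‖ * ρ) 0 with h0 | h0
    · rw [h0] at hv' ⊢; rw [zero_mul]; exact (abs_nonpos_iff.1 hv').symm
    · exact mul_div_cancel₀ _ h0
  simp only [κ]
  set τ := inner ℝ z (-c) / (‖z‖ * ρ) with hτdef
  have hτ' := abs_le.1 hτ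
  refine (two_point_cosh_le (by linarith) (by linarith) ‖z‖ ρ).trans ?_
  refine mul_le_mul_of_nonneg_left ?_ (Real.exp_pos _).le
  -- It remains to see |‖z‖ + ρτ| ≤ ‖x‖. Since x = z - c, ‖x‖² = ‖z‖² + 2‖z‖ρτ + ‖c‖², and ρ|τ| ≤
  -- ‖c‖ by Cauchy-Schwarz, so the left square is dominated.
  rw [Real.cosh_le_cosh, ← sq_le_sq]
  have hx : ‖x‖ ^ 2 = ‖z‖ ^ 2 + 2 * inner ℝ z (-c) + ‖c‖ ^ 2 := by
    have : x = z + -c := by rw [hz]; abel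
    rw [this, @norm_add_sq ℝ]; simp
  have hν : (ρ * τ) ^ 2 ≤ ‖c‖ ^ 2 := by
    rw [sq_le_sq, abs_of_nonneg (norm_nonneg c)]
    rcases (norm_nonneg z).eq_or_lt with h0 | h0
    · have : τ = 0 := by rw [hτdef, ← h0]; simp
      rw [this]; simp
    · refine le_of_mul_le_mul_left ?_ h0
      rw [← abs_of_pos h0, ← abs_mul, ← mul_assoc, abs_of_pos h0, hτm]
      exact hv
  rw [hx, ← hτm]
  nlinarith

variable [MeasurableSpace E] [BorelSpace E] [SecondCountableTopology E]

/-- Integrating out one of two independent random elements. -/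
theorem lintegral_indepFun {α β : Type*} [MeasurableSpace α] [MeasurableSpace β] {A : Ω → α}
    {B : Ω → β} (hA : Measurable A) (hB : Measurable B) (h : IndepFun A B P)
    {f : α → β → ENNReal} (hf : Measurable (Function.uncurry f)) :
    ∫⁻ ω, f (A ω) (B ω) ∂P = ∫⁻ ω, ∫⁻ ω', f (A ω) (B ω') ∂P ∂P := by
  have hmap := (indepFun_iff_map_prod_eq_prod_map_map hA.aemeasurable hB.aemeasurable).1 h
  have := Measure.isProbabilityMeasure_map (μ := P) hA.aemeasurable
  have := Measure.isProbabilityMeasure_map (μ := P) hB.aemeasurable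
  calc ∫⁻ ω, f (A ω) (B ω) ∂P
      = ∫⁻ q, Function.uncurry f q ∂(P.map fun ω => (A ω, B ω)) := by
        rw [lintegral_map hf (hA.prodMk hB)]; rfl
    _ = ∫⁻ a, ∫⁻ b, f a b ∂(P.map B) ∂(P.map A) := by
        rw [hmap, lintegral_prod _ hf.aemeasurable]; rfl
    _ = ∫⁻ a, ∫⁻ ω', f a (B ω') ∂P ∂(P.map A) := by
        refine lintegral_congr fun a => ?_
        exact lintegral_map (hf.comp measurable_prodMk_left) hB
    _ = _ := by
        rw [lintegral_map _ hA]
        exact Measurable.lintegral_prod_right' (f := fun q : α × Ω => f q.1 (B q.2))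
          (hf.comp (measurable_fst.prodMk (hB.comp measurable_snd)))

/-- The one-step estimate holds from every starting point, so integrating out one independent
summand at a time costs a factor exp(ρ²/2) each. -/
theorem lintegral_cosh_norm_sum_le {ι : Type*} {Z : ι → Ω → E} (hm : ∀ i, Measurable (Z i))
    (hind : iIndepFun Z P) (hint : ∀ i, Integrable (Z i) P) (h0 : ∀ i, ∫ ω, Z i ω ∂P = 0)
    {c : ι → E} {ρ : ι → ℝ} (hρ : ∀ i, ∀ᵐ ω ∂P, ‖Z i ω - c i‖ ≤ ρ i) (S : Finset ι) :
    ∫⁻ ω, ENNReal.ofReal (Real.cosh ‖∑ i ∈ S, Z i ω‖) ∂P ≤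
      ENNReal.ofReal (Real.exp ((∑ i ∈ S, ρ i ^ 2) / 2)) := by
  classical
  induction S using Finset.induction_on with
  | empty => simp
  | insert i S hi ih =>
    have hmS : Measurable fun ω => ∑ j ∈ S, Z j ω := Finset.measurable_sum _ fun j _ => hm j
    have hI : IndepFun (fun ω => ∑ j ∈ S, Z j ω) (Z i) P := by
      have := hind.indepFun_finsetSum_of_notMem hm hi
      convert this using 1
      ext ω; simp
    have hmeas : Measurable (Function.uncurry fun x y : E =>
        ENNReal.ofReal (Real.cosh ‖x + y‖)) :=
      (Real.continuous_cosh.measurable.comp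
        (measurable_fst.add measurable_snd).norm).ennreal_ofReal
    calc ∫⁻ ω, ENNReal.ofReal (Real.cosh ‖∑ j ∈ insert i S, Z j ω‖) ∂P
        = ∫⁻ ω, ENNReal.ofReal (Real.cosh ‖(∑ j ∈ S, Z j ω) + Z i ω‖) ∂P := by
          simp only [Finset.sum_insert hi, add_comm]
      _ = ∫⁻ ω, ∫⁻ ω', ENNReal.ofReal (Real.cosh ‖(∑ j ∈ S, Z j ω) + Z i ω'‖) ∂P ∂P :=
          lintegral_indepFun hmS (hm i) hI hmeas
      _ ≤ ∫⁻ ω, ENNReal.ofReal (Real.exp (ρ i ^ 2 / 2)) *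
            ENNReal.ofReal (Real.cosh ‖∑ j ∈ S, Z j ω‖) ∂P := by
          refine lintegral_mono fun ω => ?_
          rw [← ENNReal.ofReal_mul (Real.exp_pos _).le]
          exact lintegral_cosh_norm_add_le (hint i) (h0 i) (hρ i) _
      _ = ENNReal.ofReal (Real.exp (ρ i ^ 2 / 2)) *
            ∫⁻ ω, ENNReal.ofReal (Real.cosh ‖∑ j ∈ S, Z j ω‖) ∂P :=
          lintegral_const_mul _
            (Real.continuous_cosh.measurable.comp hmS.norm).ennreal_ofReal
      _ ≤ ENNReal.ofReal (Real.exp (ρ i ^ 2 / 2)) *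
            ENNReal.ofReal (Real.exp ((∑ j ∈ S, ρ j ^ 2) / 2)) := by gcongr
      _ = _ := by
          rw [← ENNReal.ofReal_mul (Real.exp_pos _).le, ← Real.exp_add, Finset.sum_insert hi,
            add_div]

/-- Hoeffding's inequality for sums of independent bounded random vectors in a Hilbert space. -/
theorem measure_norm_sum_ge_le {ι : Type*} {Z : ι → Ω → E} (hm : ∀ i, Measurable (Z i))
    (hind : iIndepFun Z P) (hint : ∀ i, Integrable (Z i) P) (h0 : ∀ i, ∫ ω, Z i ω ∂P = 0)
    {c : ι → E} {ρ : ι → ℝ} (hρ : ∀ i, ∀ᵐ ω ∂P, ‖Z i ω - c i‖ ≤ ρ i) (S : Finset ι)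
    {v : ℝ} (hv : 0 < v) (hSv : ∑ i ∈ S, ρ i ^ 2 ≤ v) {r : ℝ} (hr : 0 ≤ r) :
    P {ω | r ≤ ‖∑ i ∈ S, Z i ω‖} ≤ ENNReal.ofReal (2 * Real.exp (-(r ^ 2 / (2 * v)))) := by
  -- This scaling minimises the Chernoff exponent l²v/2 - lr.
  set l := r / v with hl
  have hl0 : 0 ≤ l := div_nonneg hr hv.le
  have hmS : Measurable fun ω => ∑ i ∈ S, l • Z i ω :=
    Finset.measurable_sum _ fun j _ => (hm j).const_smul l
  have key := lintegral_cosh_norm_sum_le (P := P) (Z := fun i ω => l • Z i ω)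
    (fun i => (hm i).const_smul l)
    (hind.comp (fun _ x => l • x) fun _ => measurable_const_smul l)
    (fun i => (hint i).smul l) (fun i => by rw [integral_smul, h0, smul_zero])
    (c := fun i => l • c i) (ρ := fun i => l * ρ i)
    (fun i => (hρ i).mono fun ω h => by
      rw [← smul_sub, norm_smul, Real.norm_of_nonneg hl0]; gcongr) S
  have hf : Measurable fun ω => ENNReal.ofReal (Real.cosh ‖∑ i ∈ S, l • Z i ω‖) :=
    (Real.continuous_cosh.measurable.comp hmS.norm).ennreal_ofReal
  have mk := mul_meas_ge_le_lintegral (μ := P) hf (ENNReal.ofReal (Real.exp (l * r) / 2))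
  have hsub : {ω | r ≤ ‖∑ i ∈ S, Z i ω‖} ⊆ {ω | ENNReal.ofReal (Real.exp (l * r) / 2) ≤
      ENNReal.ofReal (Real.cosh ‖∑ i ∈ S, l • Z i ω‖)} := by
    intro ω hω
    refine ENNReal.ofReal_le_ofReal ?_
    rw [← Finset.smul_sum, norm_smul, Real.norm_of_nonneg hl0, Real.cosh_eq]
    have h1 : Real.exp (l * r) ≤ Real.exp (l * ‖∑ i ∈ S, Z i ω‖) :=
      Real.exp_le_exp.2 (mul_le_mul_of_nonneg_left hω hl0)
    have h2 := Real.exp_pos (-(l * ‖∑ i ∈ S, Z i ω‖))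
    linarith
  have hpos : 0 < Real.exp (l * r) / 2 := by positivity
  have h3 : ENNReal.ofReal (Real.exp (l * r) / 2) * P {ω | r ≤ ‖∑ i ∈ S, Z i ω‖} ≤
      ENNReal.ofReal (Real.exp (l ^ 2 * v / 2)) := by
    refine (mul_le_mul_right (measure_mono hsub) _).trans (mk.trans (key.trans ?_))
    refine ENNReal.ofReal_le_ofReal (Real.exp_le_exp.2 ?_)
    simp only [mul_pow, ← Finset.mul_sum]
    gcongr
  have h4 : P {ω | r ≤ ‖∑ i ∈ S, Z i ω‖} ≤ ENNReal.ofReal (Real.exp (l ^ 2 * v / 2)) /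
      ENNReal.ofReal (Real.exp (l * r) / 2) := by
    rw [ENNReal.le_div_iff_mul_le (Or.inl (by simpa using Real.exp_pos _))
      (Or.inl ENNReal.ofReal_ne_top), mul_comm]
    exact h3
  rw [← ENNReal.ofReal_div_of_pos hpos] at h4
  refine h4.trans (ENNReal.ofReal_le_ofReal (le_of_eq ?_))
  rw [div_div_eq_mul_div, mul_comm, mul_div_assoc, ← Real.exp_sub]
  congr 2
  rw [hl]; field_simp; ring

end Hoeffding

noncomputable section
namespace CPMGame

variable {n : ℕ} {X : Type*} [MeasurableSpace X] (G : CPMGame n X)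

/-! ### Concentration of the block estimates -/

/-- The linear map through which the outcome of the `k`-th round of a block enters its estimate. -/
def blockMap (k : Fin G.s) : Vec n →L[ℝ] Vec n :=
  Matrix.toEuclideanCLM (n := Fin n) (𝕜 := ℝ)
    ((G.stacked.transpose * G.stacked)⁻¹ * ((G.M (G.σ k)).transpose * G.M (G.σ k)))

theorem betaσ_eq : G.betaσ = Real.sqrt n * ∑ k, ‖G.blockMap k‖ := rfl

theorem betaσ_nonneg : 0 ≤ G.betaσ := by
  rw [betaσ_eq]; positivity

theorem transpose_stacked_mul_self :
    G.stacked.transpose * G.stacked =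
      ∑ k, (G.M (G.σ k)).transpose * G.M (G.σ k) := by
  ext i j
  simp only [Matrix.mul_apply, Matrix.sum_apply, Matrix.transpose_apply, stacked, Matrix.of_apply]
  rw [Fintype.sum_sigma]

theorem isUnit_gram : IsUnit (G.stacked.transpose * G.stacked) := by
  have h : (G.stacked.transpose * G.stacked).rank = n := by
    rw [Matrix.rank_transpose_mul_self]; exact G.full_rank
  rw [← Matrix.linearIndependent_rows_iff_isUnit, linearIndependent_iff_card_eq_finrank_span,
    Set.finrank,
    ← Matrix.rank_eq_finrank_span_row, h, Fintype.card_fin]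

/-- This is the unbiasedness of a block estimate: the Gram matrix of the stacked matrix is the sum
of the Gram matrices of the actions. -/
theorem sum_blockMap : ∑ k, G.blockMap k = 1 := by
  simp only [blockMap]
  rw [← map_sum, ← Finset.mul_sum, ← transpose_stacked_mul_self,
    Matrix.nonsing_inv_mul _ ((Matrix.isUnit_iff_isUnit_det _).1 G.isUnit_gram), map_one]

theorem blockEst_eq (ϑ : ℕ → Vec n) (a : ℕ) :
    G.blockEst ϑ a = ∑ k : Fin G.s, G.blockMap k (ϑ (a + k)) := by
  apply (WithLp.equiv 2 (Fin n → ℝ)).injective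
  have h : G.stacked.transpose.mulVec (fun q : Σ k : Fin G.s, Fin (G.m (G.σ k)) =>
      (G.M (G.σ q.1)).mulVec (ϑ (a + q.1)).ofLp q.2) =
      ∑ k : Fin G.s, ((G.M (G.σ k)).transpose * G.M (G.σ k)).mulVec (ϑ (a + k)).ofLp := by
    ext j
    simp only [← Matrix.mulVec_mulVec]
    rw [Finset.sum_apply, Matrix.mulVec, dotProduct, Fintype.sum_sigma]
    rfl
  simp only [WithLp.equiv_apply, blockEst, pinv, ← Matrix.mulVec_mulVec, h, Matrix.mulVec_sum,
    WithLp.ofLp_sum, blockMap, Matrix.ofLp_toEuclideanCLM]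

/-- The centre of the cube. -/
def center (n : ℕ) : Vec n := WithLp.toLp 2 fun _ => 1 / 2

theorem norm_sub_center_le {θ : Vec n} (h : θ ∈ cube n) :
    ‖θ - center n‖ ≤ Real.sqrt n / 2 := by
  rw [EuclideanSpace.norm_eq, div_eq_mul_inv, ← Real.sqrt_sq (show (0 : ℝ) ≤ 2⁻¹ by norm_num),
    ← Real.sqrt_mul (Nat.cast_nonneg n)]
  refine Real.sqrt_le_sqrt ?_
  calc ∑ i, ‖(θ - center n) i‖ ^ 2 ≤ ∑ _i : Fin n, (2⁻¹ : ℝ) ^ 2 := by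
        refine Finset.sum_le_sum fun i _ => ?_
        have := h i
        rw [Real.norm_eq_abs, sq_abs]
        simp only [center, PiLp.sub_apply]
        nlinarith
    _ = _ := by simp

theorem integrable_id_p : Integrable (fun θ : Vec n => θ) G.p := by
  have := G.prob_p
  refine Integrable.of_bound (C := Real.sqrt n / 2 + ‖center n‖) measurable_id.aestronglyMeasurable ?_
  filter_upwards [G.p_cube] with θ hθ
  have h1 := norm_sub_center_le hθ
  have h2 := norm_add_le (θ - center n) (center n)
  rw [sub_add_cancel] at h2
  linarith

variable {Ω : Type*} [MeasurableSpace Ω] {P : Measure Ω} [IsProbabilityMeasure P]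
  {θ : ℕ → Ω → Vec n}

theorem avgEst_sub_mean (ϑ : ℕ → Vec n) (start : ℕ → ℕ) {b : ℕ} (hb : 1 ≤ b) :
    G.avgEst ϑ start b - G.mean = (b : ℝ)⁻¹ • ∑ q ∈ Finset.range b ×ˢ (Finset.univ : Finset (Fin G.s)),
      G.blockMap q.2 (ϑ (start q.1 + q.2) - G.mean) := by
  have hb' : (b : ℝ) ≠ 0 := by positivity
  have h1 : ∀ i, ∑ k : Fin G.s, G.blockMap k (ϑ (start i + k) - G.mean) =
      G.blockEst ϑ (start i) - G.mean := by
    intro i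
    simp only [map_sub, Finset.sum_sub_distrib, blockEst_eq]
    rw [← sum_apply, sum_blockMap]
    rfl
  rw [Finset.sum_product]
  simp only [h1, Finset.sum_sub_distrib, Finset.sum_const, Finset.card_range, smul_sub, avgEst]
  rw [← Nat.cast_smul_eq_nsmul ℝ, inv_smul_smul₀ hb']

/-- Blocks start at least `s` apart, so their outcomes are distinct and hence independent. The cube
lies in a ball of radius √n/2, and a sum of squares is at most the square of the sum, so the squared
radii add up to at most v = bβ²/4. -/
theorem measure_avgEst_ge_le (hθ : ∀ t, Measurable (θ t)) (hp : ∀ t, P.map (θ t) = G.p)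
    (hind : iIndepFun θ P) (hβ : 0 < G.betaσ) {start : ℕ → ℕ}
    (hstart : ∀ i, start i + G.s ≤ start (i + 1)) {b : ℕ} (hb : 1 ≤ b) {γ : ℝ} (hγ : 0 ≤ γ) :
    P {ω | γ ≤ G.R * ‖G.avgEst (fun i => θ i ω) start b - G.mean‖} ≤
      ENNReal.ofReal (2 * Real.exp (-(2 * b * γ ^ 2 / (G.R ^ 2 * G.betaσ ^ 2)))) := by
  have hR := G.R_pos
  have hb0 : (0 : ℝ) < b := by positivity
  let τ : ℕ × Fin G.s → ℕ := fun q => start q.1 + q.2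
  have hmono : ∀ i j, i < j → start i + G.s ≤ start j := by
    intro i j hij
    induction j, hij using Nat.le_induction with
    | base => exact hstart i
    | succ j _ ih => have := hstart j; omega
  have hτ : Function.Injective τ := by
    rintro ⟨i, k⟩ ⟨j, l⟩ h
    simp only [τ] at h
    rcases lt_trichotomy i j with hij | hij | hij
    · have := hmono i j hij; have := k.2; omega
    · subst hij
      simpa [Fin.ext_iff] using h
    · have := hmono j i hij; have := l.2; omega
  let Z : ℕ × Fin G.s → Ω → Vec n := fun q ω => G.blockMap q.2 (θ (τ q) ω - G.mean)
  have hZm : ∀ q, Measurable (Z q) := fun q =>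
    (G.blockMap q.2).continuous.measurable.comp ((hθ _).sub_const _)
  have hZind : iIndepFun Z P :=
    (hind.precomp hτ).comp (fun q x => G.blockMap q.2 (x - G.mean))
      fun q => (G.blockMap q.2).continuous.measurable.comp (measurable_id.sub_const _)
  have hθint : ∀ t, Integrable (θ t) P := fun t => by
    have h := G.integrable_id_p
    rw [← hp t] at h
    exact (integrable_map_measure h.aestronglyMeasurable (hθ t).aemeasurable).1 h
  have hθmean : ∀ t, ∫ ω, θ t ω ∂P = G.mean := fun t => by
    have h := G.integrable_id_p
    rw [← hp t] at h
    rw [mean, ← hp t]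
    exact (integral_map (hθ t).aemeasurable h.aestronglyMeasurable).symm
  have hZint : ∀ q, Integrable (Z q) P := fun q =>
    (G.blockMap q.2).integrable_comp ((hθint _).sub (integrable_const _))
  have hZ0 : ∀ q, ∫ ω, Z q ω ∂P = 0 := fun q => by
    simp only [Z]
    have h : Integrable (fun ω => θ (τ q) ω - G.mean) P := (hθint _).sub (integrable_const _)
    rw [(G.blockMap q.2).integral_comp_comm h, integral_sub (hθint _) (integrable_const _), hθmean]
    simp
  have hcube : ∀ t, ∀ᵐ ω ∂P, θ t ω ∈ cube n := fun t => by
    have h := G.p_cube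
    rw [← hp t] at h
    exact ae_of_ae_map (hθ t).aemeasurable h
  have hρ : ∀ q, ∀ᵐ ω ∂P, ‖Z q ω - G.blockMap q.2 (center n - G.mean)‖ ≤
      ‖G.blockMap q.2‖ * (Real.sqrt n / 2) := fun q => by
    filter_upwards [hcube (τ q)] with ω hω
    simp only [Z]
    rw [← map_sub, sub_sub_sub_cancel_right]
    exact ((G.blockMap q.2).le_opNorm _).trans
      (mul_le_mul_of_nonneg_left (norm_sub_center_le hω) (norm_nonneg _))
  have hv : 0 < b * G.betaσ ^ 2 / 4 := by positivity
  have hsum : ∑ q ∈ Finset.range b ×ˢ (Finset.univ : Finset (Fin G.s)),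
      (‖G.blockMap q.2‖ * (Real.sqrt n / 2)) ^ 2 ≤ b * G.betaσ ^ 2 / 4 := by
    rw [Finset.sum_product]
    dsimp only
    rw [Finset.sum_const, Finset.card_range, nsmul_eq_mul, mul_div_assoc]
    refine mul_le_mul_of_nonneg_left ?_ hb0.le
    simp only [mul_pow, ← Finset.sum_mul]
    have h : ∑ k, ‖G.blockMap k‖ ^ 2 ≤ (∑ k, ‖G.blockMap k‖) ^ 2 :=
      Finset.sum_sq_le_sq_sum_of_nonneg fun k _ => norm_nonneg _
    rw [betaσ_eq, mul_pow, div_pow]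
    have := mul_le_mul_of_nonneg_right h (show 0 ≤ Real.sqrt n ^ 2 / 4 by positivity)
    linarith
  have key := measure_norm_sum_ge_le hZm hZind hZint hZ0 hρ
    (Finset.range b ×ˢ (Finset.univ : Finset (Fin G.s))) hv hsum
    (r := b * γ / G.R) (by positivity)
  refine (measure_mono ?_).trans (key.trans (ENNReal.ofReal_le_ofReal (le_of_eq ?_)))
  · intro ω hω
    simp only [Set.mem_ofPred_eq] at hω ⊢
    rw [G.avgEst_sub_mean _ _ hb, norm_smul, norm_inv, Real.norm_of_nonneg hb0.le] at hω
    rw [div_le_iff₀ hR]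
    have := mul_le_mul_of_nonneg_left hω hb0.le
    refine this.trans (le_of_eq ?_)
    field_simp
    rfl
  · congr 3
    field_simp
    ring

end CPMGame
end

noncomputable section
namespace CPMGame

variable {n : ℕ} {X : Type*} [MeasurableSpace X] {G : CPMGame n X} {am : Vec n → X}

/-! ### Gaps and estimated gaps -/

theorem IsArgmaxOracle.iSup_eq (ho : G.IsArgmaxOracle am) (v : Vec n) :
    ⨆ x, G.rbar x v = G.rbar (am v) v := by
  have : Nonempty X := ⟨am v⟩
  exact le_antisymm (ciSup_le (ho v)) (le_ciSup ⟨_, Set.forall_mem_range.2 (ho v)⟩ (am v))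

theorem IsArgmaxOracle.gap_eq (ho : G.IsArgmaxOracle am) (x : X) :
    G.gap x = G.rbar (am G.mean) G.mean - G.rbar x G.mean := by
  rw [gap, ho.iSup_eq]

theorem IsArgmaxOracle.gap_nonneg (ho : G.IsArgmaxOracle am) (x : X) : 0 ≤ G.gap x := by
  rw [ho.gap_eq]; exact sub_nonneg.2 (ho _ _)

/-- At `v` the action `am v` beats the true optimum; passing from `v` to the mean changes each of
the two rewards by at most the error. -/
theorem IsArgmaxOracle.gap_argmax_le (ho : G.IsArgmaxOracle am) (v : Vec n) :
    G.gap (am v) ≤ 2 * (G.R * ‖v - G.mean‖) := by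
  rw [ho.gap_eq]
  have h1 := abs_le.1 (G.lipschitz (am v) v G.mean)
  have h2 := abs_le.1 (G.lipschitz (am G.mean) v G.mean)
  have h3 := ho v (am G.mean)
  linarith [h1.2, h2.1]

theorem IsArgmaxOracle.estGap_le (ho : G.IsArgmaxOracle am) {v : Vec n} {x : X} (hx : x ≠ am v) :
    G.estGap am v ≤ G.rbar (am v) v - G.rbar x v := by
  have hb : BddAbove {u | ∃ x, x ≠ am v ∧ u = G.rbar x v} :=
    ⟨G.rbar (am v) v, by rintro _ ⟨y, _, rfl⟩; exact ho v y⟩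
  exact sub_le_sub_left (le_csSup hb ⟨x, hx, rfl⟩) _

/-- With a single action the supremum over the others is `sSup ∅ = 0`, and `estGap` loses its
meaning; hence `Nontrivial X`. -/
theorem le_estGap [Nontrivial X] {v : Vec n} {c : ℝ}
    (h : ∀ x, x ≠ am v → G.rbar x v ≤ G.rbar (am v) v - c) : c ≤ G.estGap am v := by
  obtain ⟨y, hy⟩ := exists_ne (am v)
  have : sSup {u | ∃ x, x ≠ am v ∧ u = G.rbar x v} ≤ G.rbar (am v) v - c := by
    refine csSup_le ⟨_, y, hy, rfl⟩ ?_
    rintro _ ⟨x, hx, rfl⟩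
    exact h x hx
  rw [estGap]
  linarith

/-- This Lipschitz bound makes `estGap` continuous, hence measurable, even though `am` itself may
jump. -/
theorem IsArgmaxOracle.estGap_sub_le [Nontrivial X] (ho : G.IsArgmaxOracle am) (v v' : Vec n) :
    G.estGap am v - 2 * (G.R * ‖v - v'‖) ≤ G.estGap am v' := by
  have hL : ∀ x, |G.rbar x v - G.rbar x v'| ≤ G.R * ‖v - v'‖ := fun x => G.lipschitz x v v'
  refine le_estGap fun x hx => ?_
  have h1 := ho v' (am v)
  have h2 := abs_le.1 (hL (am v))
  rcases eq_or_ne x (am v) with rfl | hxv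
  · have h3 := ho.estGap_le (v := v) hx.symm
    have h4 := abs_le.1 (hL (am v'))
    linarith [h2.1, h2.2, h4.1, h4.2]
  · have h3 := ho.estGap_le hxv
    have h4 := abs_le.1 (hL x)
    linarith [h2.1, h2.2, h4.1, h4.2]

theorem IsArgmaxOracle.continuous_estGap [Nontrivial X] (ho : G.IsArgmaxOracle am) :
    Continuous (G.estGap am) := by
  refine (LipschitzWith.of_dist_le_mul (K := (2 * G.R).toNNReal)
    fun v v' => ?_).continuous
  have h1 := ho.estGap_sub_le v v'
  have h2 := ho.estGap_sub_le v' v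
  rw [norm_sub_rev] at h2
  rw [Real.dist_eq, dist_eq_norm, abs_le, Real.coe_toNNReal _ (by linarith [G.R_pos])]
  constructor <;> linarith

/-- Of two distinct optimal actions at least one differs from `am v`, and it competes for the second
best value at `v`. -/
theorem IsArgmaxOracle.estGap_le_of_not_uniqueOptimal (ho : G.IsArgmaxOracle am)
    (h : ¬ G.UniqueOptimal) (v : Vec n) : G.estGap am v ≤ 2 * (G.R * ‖v - G.mean‖) := by
  obtain ⟨y, hy, hne⟩ : ∃ y, (∀ x, G.rbar x G.mean ≤ G.rbar y G.mean) ∧ y ≠ am G.mean := by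
    by_contra! hc
    exact h ⟨am G.mean, ho _, hc⟩
  obtain ⟨z, hz, hzv⟩ : ∃ z, (∀ x, G.rbar x G.mean ≤ G.rbar z G.mean) ∧ z ≠ am v := by
    rcases eq_or_ne y (am v) with rfl | hyv
    · exact ⟨_, ho G.mean, hne.symm⟩
    · exact ⟨y, hy, hyv⟩
  have h1 := ho.estGap_le hzv
  have h2 := hz (am v)
  have h3 := abs_le.1 (G.lipschitz (am v) v G.mean)
  have h4 := abs_le.1 (G.lipschitz z v G.mean)
  linarith [h3.2, h4.1]

theorem IsArgmaxOracle.minGap_le (ho : G.IsArgmaxOracle am) {x : X} (hx : 0 < G.gap x) :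
    G.minGap ≤ G.gap x :=
  csInf_le ⟨0, by rintro _ ⟨y, rfl, _⟩; exact ho.gap_nonneg y⟩ ⟨x, rfl, hx⟩

theorem IsArgmaxOracle.gap_argmax_eq_zero (ho : G.IsArgmaxOracle am) {v : Vec n}
    (hv : G.R * ‖v - G.mean‖ < G.minGap / 2) : G.gap (am v) = 0 := by
  by_contra h
  have h1 := ho.minGap_le (lt_of_le_of_ne (ho.gap_nonneg _) (Ne.symm h))
  have h2 := ho.gap_argmax_le v
  linarith

theorem IsArgmaxOracle.gap_pos_of_ne (ho : G.IsArgmaxOracle am) (hu : G.UniqueOptimal) {x : X}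
    (hx : x ≠ am G.mean) : 0 < G.gap x := by
  refine lt_of_le_of_ne (ho.gap_nonneg x) fun h => hx ?_
  rw [ho.gap_eq] at h
  refine hu.unique (fun y => ?_) (ho G.mean)
  have := ho G.mean y
  linarith

theorem IsArgmaxOracle.minGap_sub_le_estGap [Nontrivial X] (ho : G.IsArgmaxOracle am)
    (hu : G.UniqueOptimal) (v : Vec n) :
    G.minGap - 2 * (G.R * ‖v - G.mean‖) ≤ G.estGap am v := by
  have hL : ∀ x, |G.rbar x v - G.rbar x G.mean| ≤ G.R * ‖v - G.mean‖ :=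
    fun x => G.lipschitz x v G.mean
  have hmin : ∀ x, x ≠ am G.mean → G.minGap ≤ G.rbar (am G.mean) G.mean - G.rbar x G.mean := by
    intro x hx
    rw [← ho.gap_eq]
    exact ho.minGap_le (ho.gap_pos_of_ne hu hx)
  refine le_estGap fun x hx => ?_
  have h1 := ho v (am G.mean)
  have h2 := abs_le.1 (hL (am G.mean))
  rcases eq_or_ne x (am G.mean) with rfl | hxs
  · have h3 := hmin _ hx.symm
    have h4 := abs_le.1 (hL (am v))
    linarith [h2.1, h2.2, h4.1, h4.2]
  · have h3 := hmin _ hxs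
    have h4 := abs_le.1 (hL x)
    linarith [h2.1, h2.2, h4.1, h4.2]

theorem IsArgmaxOracle.estGap_le_minGap_add (ho : G.IsArgmaxOracle am)
    (hpos : 0 < G.minGap) (v : Vec n) :
    G.estGap am v ≤ G.minGap + 2 * (G.R * ‖v - G.mean‖) := by
  have hL : ∀ x, |G.rbar x v - G.rbar x G.mean| ≤ G.R * ‖v - G.mean‖ :=
    fun x => G.lipschitz x v G.mean
  have h2 := abs_le.1 (hL (am G.mean))
  have h4 := abs_le.1 (hL (am v))
  have h5 := ho G.mean (am v)
  rcases eq_or_ne (am G.mean) (am v) with heq | hne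
  · suffices h : G.estGap am v - 2 * (G.R * ‖v - G.mean‖) ≤ G.minGap by linarith
    -- The infimum of the empty set is 0, so a positive `minGap` already exhibits a suboptimal
    -- action.
    have hn : {d | ∃ x, d = G.gap x ∧ 0 < G.gap x}.Nonempty := by
      by_contra hc
      rw [Set.not_nonempty_iff_eq_empty] at hc
      rw [minGap, hc, Real.sInf_empty] at hpos
      exact lt_irrefl _ hpos
    refine le_csInf hn ?_
    rintro _ ⟨x, rfl, hx⟩
    have hxv : x ≠ am v := by
      rintro rfl
      rw [ho.gap_eq, heq, sub_self] at hx
      exact lt_irrefl _ hx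
    have h6 := ho.estGap_le hxv
    have h7 := abs_le.1 (hL x)
    rw [ho.gap_eq, heq]
    linarith [h2.1, h2.2, h4.1, h4.2, h7.1, h7.2]
  · have h6 := ho.estGap_le hne
    linarith [h2.1, h2.2, h4.1, h4.2]

theorem width_nonneg (δ : ℝ) (b : ℕ) : 0 ≤ G.width δ b := Real.sqrt_nonneg _

theorem IsArgmaxOracle.gapFound_iff (ho : G.IsArgmaxOracle am) {δ : ℝ} {ϑ : ℕ → Vec n} {b : ℕ} :
    G.GapFound am δ ϑ b ↔
      6 * G.width δ b < G.estGap am (G.avgEst ϑ (fun i => i * G.s) b) := by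
  refine ⟨fun h => h.2, fun h => ⟨fun x hx => ?_, h⟩⟩
  have h1 := ho.estGap_le hx
  have h2 := G.width_nonneg δ b
  linarith

-- No regularity of `rbar` in the action is assumed; measurability comes from writing the reward at
-- the mean as an integral of `r`.
variable (G) in
theorem measurable_gap : Measurable G.gap := by
  have := G.prob_p
  have h : Measurable fun x => ∫ v, G.r x v ∂G.p :=
    (StronglyMeasurable.integral_prod_right (f := G.r) G.measurable_r.stronglyMeasurable).measurable
  simp only [G.expected_r] at h
  exact h.const_sub _

/-! ### Measurability of the estimates and actions -/

/-- Handles random episode counts, phase indices and starting times: it suffices to treat each fixed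
value. -/
theorem measurable_comp_countable {ι α β : Type*} [Countable ι] [MeasurableSpace ι]
    [MeasurableSingletonClass ι] [MeasurableSpace α] [MeasurableSpace β] {f : ι → α → β}
    {g : α → ι} (hf : ∀ i, Measurable (f i)) (hg : Measurable g) :
    Measurable fun a => f (g a) a :=
  (measurable_from_prod_countable_right (f := Function.uncurry f) hf).comp
    (hg.prodMk measurable_id)

theorem measurable_nat_sInf {α : Type*} [MeasurableSpace α] {p : α → ℕ → Prop}
    (hp : ∀ a, {k | p a k}.Nonempty) (hm : ∀ k, MeasurableSet {a | p a k}) :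
    Measurable fun a => sInf {k | p a k} := by
  classical
  have h : (fun a => sInf {k | p a k}) = fun a => Nat.find (hp a) := by
    funext a
    rw [Nat.sInf_def (hp a)]
  rw [h]
  exact measurable_find hp hm

variable (G) in
theorem measurable_blockEst (a : ℕ) : Measurable fun ϑ : ℕ → Vec n => G.blockEst ϑ a := by
  simp only [blockEst_eq]
  refine Finset.measurable_sum (f := fun (k : Fin G.s) (ϑ : ℕ → Vec n) =>
    G.blockMap k (ϑ (a + k))) _ fun k _ => ?_
  exact (G.blockMap k).continuous.measurable.comp (measurable_pi_apply _)

variable (G) in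
theorem measurable_avgEst {α : Type*} [MeasurableSpace α] {ϑ : α → ℕ → Vec n} {start : α → ℕ → ℕ}
    (hϑ : Measurable ϑ) (hst : ∀ i, Measurable fun a => start a i) (b : ℕ) :
    Measurable fun a => G.avgEst (ϑ a) (start a) b := by
  have h : ∀ i, Measurable fun a => G.blockEst (ϑ a) (start a i) := fun i =>
    measurable_comp_countable (f := fun k a => G.blockEst (ϑ a) k)
      (fun k => (G.measurable_blockEst k).comp hϑ) (hst i)
  have h2 : Measurable fun a => ∑ i ∈ Finset.range b, G.blockEst (ϑ a) (start a i) :=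
    Finset.measurable_sum _ fun i _ => h i
  exact h2.const_smul (b : ℝ)⁻¹

variable (G) in
theorem measurable_avgEst_mul (b : ℕ) :
    Measurable fun ϑ : ℕ → Vec n => G.avgEst ϑ (fun i => i * G.s) b :=
  G.measurable_avgEst (ϑ := fun ϑ => ϑ) (start := fun _ i => i * G.s) measurable_id
    (fun _ => measurable_const) b

variable (G) in
theorem gapEpisodes_set_nonempty (am : Vec n → X) (τ δ : ℝ) (ϑ : ℕ → Vec n) :
    {b : ℕ | 1 ≤ b ∧ (G.GapFound am δ ϑ b ∨ τ < b)}.Nonempty :=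
  ⟨⌊τ⌋₊ + 1, Nat.le_add_left _ _, Or.inr (by exact_mod_cast Nat.lt_floor_add_one τ)⟩

theorem measurableSet_gapFound [Nontrivial X] (ho : G.IsArgmaxOracle am) (δ : ℝ) (b : ℕ) :
    MeasurableSet {ϑ | G.GapFound am δ ϑ b} := by
  simp only [ho.gapFound_iff]
  exact measurableSet_lt measurable_const (ho.continuous_estGap.measurable.comp
    (G.measurable_avgEst_mul b))

theorem measurable_gapEpisodes [Nontrivial X] (ho : G.IsArgmaxOracle am) (τ δ : ℝ) :
    Measurable (G.gapEpisodes am τ δ) := by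
  refine measurable_nat_sInf (G.gapEpisodes_set_nonempty am τ δ) fun k => ?_
  exact (MeasurableSet.const _).inter ((measurableSet_gapFound ho δ k).union (MeasurableSet.const _))

variable (G) in
theorem phaseStart_succ (h : ℝ) (a₀ j : ℕ) : G.phaseStart h a₀ (j + 1) =
    G.phaseStart h a₀ j + (G.s + ⌊Real.exp (h * ((j : ℝ) + 1))⌋₊) := by
  rw [phaseStart, Finset.sum_range_succ, phaseStart, add_assoc]

variable (G) in
theorem phaseStart_add_le {i j : ℕ} (h : ℝ) (a₀ : ℕ) (hij : i < j) :
    G.phaseStart h a₀ i + G.s ≤ G.phaseStart h a₀ j := by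
  induction j, hij using Nat.le_induction with
  | base => rw [phaseStart_succ]; omega
  | succ j _ ih => rw [phaseStart_succ]; omega

variable (G) in
theorem le_phaseStart (h : ℝ) (a₀ j : ℕ) : a₀ ≤ G.phaseStart h a₀ j := Nat.le_add_right _ _

variable (G) in
theorem add_le_phaseStart (hs : 0 < G.s) (h : ℝ) (a₀ j : ℕ) : a₀ + j ≤ G.phaseStart h a₀ j := by
  induction j with
  | zero => exact G.le_phaseStart h a₀ 0
  | succ j ih => rw [phaseStart_succ]; omega

variable (G) in
theorem phaseIndex_set_nonempty (hs : 0 < G.s) (h : ℝ) (a₀ t : ℕ) :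
    {j | t < G.phaseStart h a₀ (j + 1)}.Nonempty :=
  ⟨t, by have := G.add_le_phaseStart hs h a₀ (t + 1); simp only [Set.mem_ofPred_eq]; omega⟩

theorem phaseIndex_eq (hs : 0 < G.s) {h : ℝ} {a₀ t j : ℕ} (h1 : G.phaseStart h a₀ j ≤ t)
    (h2 : t < G.phaseStart h a₀ (j + 1)) : G.phaseIndex h a₀ t = j := by
  refine le_antisymm (Nat.sInf_le h2) ?_
  have h3 : t < G.phaseStart h a₀ (G.phaseIndex h a₀ t + 1) :=
    Nat.sInf_mem (G.phaseIndex_set_nonempty hs h a₀ t)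
  by_contra! hc
  have : G.phaseStart h a₀ (G.phaseIndex h a₀ t + 1) ≤ G.phaseStart h a₀ j := by
    rcases (Nat.succ_le_of_lt hc).eq_or_lt with h4 | h4
    · exact le_of_eq (congrArg _ h4)
    · rw [Nat.succ_eq_add_one] at h4
      have := G.phaseStart_add_le h a₀ h4
      omega
  omega

variable (G) in
theorem measurable_phaseStart (a₀ j : ℕ) : Measurable fun h => G.phaseStart h a₀ j := by
  refine Measurable.const_add (Finset.measurable_sum _ fun i _ => Measurable.const_add ?_ _) _
  exact Nat.measurable_floor.comp (Real.measurable_exp.comp (measurable_id.mul_const _))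

theorem measurable_phaseIndex (hs : 0 < G.s) (a₀ t : ℕ) :
    Measurable fun h => G.phaseIndex h a₀ t := by
  refine measurable_nat_sInf (fun h => G.phaseIndex_set_nonempty hs h a₀ t) fun k => ?_
  exact measurableSet_lt measurable_const (G.measurable_phaseStart a₀ (k + 1))

theorem measurable_pegeAction (hs : 0 < G.s) (ham : Measurable am) (a₀ t : ℕ) :
    Measurable fun q : ℝ × (ℕ → Vec n) => G.pegeAction am q.1 a₀ q.2 t := by
  have hj : Measurable fun q : ℝ × (ℕ → Vec n) => G.phaseIndex q.1 a₀ t :=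
    (measurable_phaseIndex hs a₀ t).comp measurable_fst
  have hst : ∀ j, Measurable fun q : ℝ × (ℕ → Vec n) => G.phaseStart q.1 a₀ j := fun j =>
    (G.measurable_phaseStart a₀ j).comp measurable_fst
  refine measurable_comp_countable (ι := ℕ × ℕ) (f := fun k (q : ℝ × (ℕ → Vec n)) =>
    if hk : t - k.2 < G.s then G.σ ⟨t - k.2, hk⟩
    else am (G.avgEst q.2 (G.phaseStart q.1 a₀) (k.1 + 1)))
    (g := fun q => (G.phaseIndex q.1 a₀ t, G.phaseStart q.1 a₀ (G.phaseIndex q.1 a₀ t)))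
    (fun k => ?_)
    (hj.prodMk (measurable_comp_countable (f := fun j (q : ℝ × (ℕ → Vec n)) =>
      G.phaseStart q.1 a₀ j) hst hj))
  by_cases hk : t - k.2 < G.s
  · simp only [hk, dif_pos]
    exact measurable_const
  · simp only [hk, dif_neg, not_false_eq_true]
    exact ham.comp (G.measurable_avgEst measurable_snd hst _)

/-- The exploitation rule of PEGE2 after `N` episodes of gap estimation. -/
def commitAction (G : CPMGame n X) (am : Vec n → X) (T N : ℕ) (ϑ : ℕ → Vec n) (t : ℕ) : X :=
  open scoped Classical in
  if G.GapFound am (1 / T) ϑ N then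
    G.pegeAction am (G.estGap am (G.avgEst ϑ (fun i => i * G.s) N) ^ 2 /
      (9 * G.R ^ 2 * G.betaσ ^ 2)) (N * G.s) ϑ t
  else am (G.avgEst ϑ (fun i => i * G.s) N)

theorem pege2Action_of_lt (hs : 0 < G.s) {T t : ℕ} {ϑ : ℕ → Vec n}
    (ht : t < G.gapEpisodes am (G.T₀ T) (1 / T) ϑ * G.s) :
    G.pege2Action am T ϑ t = G.σ ⟨t % G.s, Nat.mod_lt _ hs⟩ :=
  dif_pos ht

theorem pege2Action_of_le {T t : ℕ} {ϑ : ℕ → Vec n}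
    (ht : G.gapEpisodes am (G.T₀ T) (1 / T) ϑ * G.s ≤ t) :
    G.pege2Action am T ϑ t =
      commitAction G am T (G.gapEpisodes am (G.T₀ T) (1 / T) ϑ) ϑ t :=
  dif_neg (not_lt.2 ht)

theorem measurable_commitAction [Nontrivial X] (hs : 0 < G.s) (ham : Measurable am)
    (ho : G.IsArgmaxOracle am) (T N t : ℕ) : Measurable fun ϑ => commitAction G am T N ϑ t := by
  have hav : Measurable fun ϑ : ℕ → Vec n => G.avgEst ϑ (fun i => i * G.s) N :=
    G.measurable_avgEst_mul N
  have hg : Measurable fun ϑ : ℕ → Vec n =>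
      (G.estGap am (G.avgEst ϑ (fun i => i * G.s) N) ^ 2 / (9 * G.R ^ 2 * G.betaσ ^ 2), ϑ) :=
    (((ho.continuous_estGap.measurable.comp hav).pow_const 2).div_const _).prodMk measurable_id
  have hp := (measurable_pegeAction hs ham (N * G.s) t).comp hg
  exact Measurable.ite (measurableSet_gapFound ho _ N) hp (ham.comp hav)

theorem measurable_pege2Action [Nontrivial X] (hs : 0 < G.s) (ham : Measurable am)
    (ho : G.IsArgmaxOracle am) (T t : ℕ) : Measurable fun ϑ => G.pege2Action am T ϑ t := by
  have h : ∀ ϑ, G.pege2Action am T ϑ t =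
      (fun N ϑ => if t < N * G.s then G.σ ⟨t % G.s, Nat.mod_lt _ hs⟩ else
        commitAction G am T N ϑ t) (G.gapEpisodes am (G.T₀ T) (1 / T) ϑ) ϑ := by
    intro ϑ
    dsimp only
    split_ifs with ht
    · exact pege2Action_of_lt hs ht
    · exact pege2Action_of_le (not_lt.1 ht)
  simp only [h]
  refine measurable_comp_countable (ι := ℕ) (f := fun N ϑ =>
    if t < N * G.s then G.σ ⟨t % G.s, Nat.mod_lt _ hs⟩ else commitAction G am T N ϑ t)
    (fun N => ?_) (measurable_gapEpisodes ho _ _)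
  by_cases ht : t < N * G.s
  · simp only [ht, if_true]
    exact measurable_const
  · simp only [ht, if_false]
    exact measurable_commitAction hs ham ho T N t

/-! ### Actions depend only on the past -/

variable {ϑ ϑ' : ℕ → Vec n}

theorem blockEst_congr {a : ℕ} (h : ∀ i, a ≤ i → i < a + G.s → ϑ i = ϑ' i) :
    G.blockEst ϑ a = G.blockEst ϑ' a := by
  simp only [blockEst_eq]
  exact Finset.sum_congr rfl fun k _ => by rw [h _ (by omega) (by omega)]

theorem avgEst_congr {start : ℕ → ℕ} {b : ℕ}
    (h : ∀ j < b, ∀ i, start j ≤ i → i < start j + G.s → ϑ i = ϑ' i) :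
    G.avgEst ϑ start b = G.avgEst ϑ' start b := by
  rw [avgEst, avgEst, Finset.sum_congr rfl fun j hj => blockEst_congr (h j (Finset.mem_range.1 hj))]

theorem avgEst_mul_congr {b : ℕ} (h : ∀ i < b * G.s, ϑ i = ϑ' i) :
    G.avgEst ϑ (fun i => i * G.s) b = G.avgEst ϑ' (fun i => i * G.s) b := by
  refine avgEst_congr fun j hj i _ hi => h i (hi.trans_le ?_)
  rw [← Nat.succ_mul]
  exact Nat.mul_le_mul_right _ hj

theorem gapFound_congr {δ : ℝ} {b : ℕ} (h : ∀ i < b * G.s, ϑ i = ϑ' i) :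
    G.GapFound am δ ϑ b ↔ G.GapFound am δ ϑ' b := by
  rw [GapFound, GapFound, avgEst_mul_congr h]

variable (G) in
theorem gapEpisodes_mem (am : Vec n → X) (τ δ : ℝ) (ϑ : ℕ → Vec n) :
    1 ≤ G.gapEpisodes am τ δ ϑ ∧
      (G.GapFound am δ ϑ (G.gapEpisodes am τ δ ϑ) ∨ τ < G.gapEpisodes am τ δ ϑ) :=
  Nat.sInf_mem (G.gapEpisodes_set_nonempty am τ δ ϑ)

theorem gapEpisodes_le {τ δ : ℝ} {b : ℕ} (hb : 1 ≤ b) (h : G.GapFound am δ ϑ b ∨ τ < b) :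
    G.gapEpisodes am τ δ ϑ ≤ b :=
  Nat.sInf_le ⟨hb, h⟩

/-- The stopping property: the number of episodes is determined by the outcomes observed up to the
stop. -/
theorem gapEpisodes_congr {τ δ : ℝ} (h : ∀ i < G.gapEpisodes am τ δ ϑ * G.s, ϑ i = ϑ' i) :
    G.gapEpisodes am τ δ ϑ' = G.gapEpisodes am τ δ ϑ := by
  obtain ⟨h1, h2⟩ := G.gapEpisodes_mem am τ δ ϑ
  have hle : G.gapEpisodes am τ δ ϑ' ≤ G.gapEpisodes am τ δ ϑ :=
    gapEpisodes_le h1 (h2.imp_left (gapFound_congr h).1)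
  refine le_antisymm hle ?_
  obtain ⟨h3, h4⟩ := G.gapEpisodes_mem am τ δ ϑ'
  refine gapEpisodes_le h3 (h4.imp_left (gapFound_congr fun i hi => h i ?_).2)
  exact hi.trans_le (Nat.mul_le_mul_right _ hle)

theorem pegeAction_congr (hs : 0 < G.s) {h : ℝ} {a₀ t : ℕ}
    (hϑ : ∀ i, a₀ ≤ i → i < t → ϑ i = ϑ' i) :
    G.pegeAction am h a₀ ϑ t = G.pegeAction am h a₀ ϑ' t := by
  unfold pegeAction
  dsimp only
  split_ifs with hk
  · rfl
  · rw [avgEst_congr]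
    intro j hj i hi1 hi2
    refine hϑ i ((G.le_phaseStart h a₀ j).trans hi1) ?_
    rcases (Nat.lt_succ_iff.1 hj).eq_or_lt with rfl | hj'
    · omega
    · have := G.phaseStart_add_le h a₀ hj'
      omega

theorem commitAction_congr (hs : 0 < G.s) {T N t : ℕ} (hN : N * G.s ≤ t)
    (h : ∀ i < t, ϑ i = ϑ' i) : commitAction G am T N ϑ t = commitAction G am T N ϑ' t := by
  have h' : ∀ i < N * G.s, ϑ i = ϑ' i := fun i hi => h i (hi.trans_le hN)
  unfold commitAction
  rw [avgEst_mul_congr h', pegeAction_congr hs fun i _ hi => h i hi]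
  have hg : G.GapFound am (1 / T) ϑ N ↔ G.GapFound am (1 / T) ϑ' N := gapFound_congr h'
  by_cases hf : G.GapFound am (1 / T) ϑ N
  · rw [if_pos hf, if_pos (hg.1 hf)]
  · rw [if_neg hf, if_neg (hg.not.1 hf)]

theorem pege2Action_congr (hs : 0 < G.s) {T t : ℕ} (h : ∀ i < t, ϑ i = ϑ' i) :
    G.pege2Action am T ϑ t = G.pege2Action am T ϑ' t := by
  -- If gap estimation has ended by time `t` for one of the sequences, it ends at the same episode
  -- for the other; otherwise both are still exploring and follow the same schedule.
  have aux : ∀ {ϑ ϑ' : ℕ → Vec n}, (∀ i < t, ϑ i = ϑ' i) →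
      G.gapEpisodes am (G.T₀ T) (1 / T) ϑ * G.s ≤ t →
      G.pege2Action am T ϑ t = G.pege2Action am T ϑ' t := by
    intro ϑ ϑ' h hN
    have hN' := gapEpisodes_congr (am := am) (τ := G.T₀ T) (δ := 1 / T)
      fun i hi => h i (hi.trans_le hN)
    rw [pege2Action_of_le hN, pege2Action_of_le (by rwa [hN']), hN', commitAction_congr hs hN h]
  rcases le_or_gt (G.gapEpisodes am (G.T₀ T) (1 / T) ϑ * G.s) t with h1 | h1
  · exact aux h h1
  rcases le_or_gt (G.gapEpisodes am (G.T₀ T) (1 / T) ϑ' * G.s) t with h2 | h2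
  · exact (aux (fun i hi => (h i hi).symm) h2).symm
  · rw [pege2Action_of_lt hs h1, pege2Action_of_lt hs h2]

end CPMGame
end

noncomputable section
namespace CPMGame

variable {n : ℕ} {X : Type*} [MeasurableSpace X] {G : CPMGame n X} {am : Vec n → X}
  {Ω : Type*} [MeasurableSpace Ω] {P : Measure Ω} [IsProbabilityMeasure P] {θ : ℕ → Ω → Vec n}

/-! ### Decomposition of the regret -/

/-- The sequence `u` with all terms outside `S` replaced by `0`. -/
def restrictSeq (S : Finset ℕ) (u : ℕ → Vec n) : ℕ → Vec n := fun i => if i ∈ S then u i else 0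

theorem restrictSeq_of_mem {S : Finset ℕ} {u : ℕ → Vec n} {i : ℕ} (hi : i ∈ S) :
    restrictSeq S u i = u i := if_pos hi

theorem measurable_seq (hθ : ∀ t, Measurable (θ t)) :
    Measurable fun ω => (fun i => θ i ω : ℕ → Vec n) := measurable_pi_lambda _ hθ

theorem measurable_restrictSeq (S : Finset ℕ) : Measurable (restrictSeq (n := n) S) := by
  refine measurable_pi_lambda _ fun i => ?_
  by_cases hi : i ∈ S
  · simp only [restrictSeq, hi, if_true]
    exact measurable_pi_apply i
  · simp only [restrictSeq, hi, if_false]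
    exact measurable_const

/-- Extending by 0 keeps both parts in the type of full sequences, so the functions of the algorithm
apply to them directly. -/
theorem indepFun_restrictSeq (hθ : ∀ t, Measurable (θ t)) (hind : iIndepFun θ P) {S U : Finset ℕ}
    (h : Disjoint S U) :
    IndepFun (fun ω => restrictSeq S fun i => θ i ω) (fun ω => restrictSeq U fun i => θ i ω) P := by
  let ext : (V : Finset ℕ) → (V → Vec n) → ℕ → Vec n := fun V v i =>
    if hi : i ∈ V then v ⟨i, hi⟩ else 0
  have hext : ∀ V, Measurable (ext V) := by
    intro V
    refine measurable_pi_lambda _ fun i => ?_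
    by_cases hi : i ∈ V
    · simp only [ext, hi, dif_pos]
      exact measurable_pi_apply _
    · simp only [ext, hi, dif_neg, not_false_eq_true]
      exact measurable_const
  exact (hind.indepFun_finset S U h hθ).comp (hext S) (hext U)

/-- If an action depends only on the past, its expected reward is that of the mean. -/
theorem integral_reward_eq (hθ : ∀ t, Measurable (θ t)) (hp : ∀ t, P.map (θ t) = G.p)
    (hind : iIndepFun θ P) {t : ℕ} {F : (ℕ → Vec n) → X} (hF : Measurable F)
    (hcongr : ∀ ϑ ϑ' : ℕ → Vec n, (∀ i < t, ϑ i = ϑ' i) → F ϑ = F ϑ')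
    (hint : Integrable (fun ω => G.r (F fun i => θ i ω) (θ t ω)) P) :
    ∫ ω, G.r (F fun i => θ i ω) (θ t ω) ∂P = ∫ ω, G.rbar (F fun i => θ i ω) G.mean ∂P := by
  have := G.prob_p
  set x : Ω → X := fun ω => F fun i => θ i ω with hx
  have hxm : Measurable x := hF.comp (measurable_seq hθ)
  have hI : IndepFun x (θ t) P := by
    have h1 : IndepFun (fun ω => restrictSeq (Finset.range t) fun i => θ i ω)
        (fun ω => restrictSeq {t} fun i => θ i ω) P := indepFun_restrictSeq hθ hind (by simp)
    have h2 := h1.comp hF (measurable_pi_apply t)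
    convert h2 using 1
    · funext ω
      exact hcongr _ _ fun i hi =>
        (restrictSeq_of_mem (u := fun i => θ i ω) (Finset.mem_range.2 hi)).symm
    · funext ω
      exact (restrictSeq_of_mem (u := fun i => θ i ω) (Finset.mem_singleton_self t)).symm
  have hmap := (indepFun_iff_map_prod_eq_prod_map_map hxm.aemeasurable (hθ t).aemeasurable).1 hI
  rw [hp t] at hmap
  have := Measure.isProbabilityMeasure_map (μ := P) hxm.aemeasurable
  have hpair : Measurable fun ω => (x ω, θ t ω) := hxm.prodMk (hθ t)
  have hr : AEStronglyMeasurable (Function.uncurry G.r) (P.map fun ω => (x ω, θ t ω)) :=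
    G.measurable_r.aestronglyMeasurable
  have hint' : Integrable (Function.uncurry G.r) ((P.map x).prod G.p) := by
    rw [← hmap, integrable_map_measure hr hpair.aemeasurable]
    exact hint
  calc ∫ ω, G.r (x ω) (θ t ω) ∂P
      = ∫ q, Function.uncurry G.r q ∂(P.map fun ω => (x ω, θ t ω)) :=
        (integral_map hpair.aemeasurable hr).symm
    _ = ∫ y, ∫ v, G.r y v ∂G.p ∂(P.map x) := by rw [hmap, integral_prod _ hint']; rfl
    _ = ∫ y, G.rbar y G.mean ∂(P.map x) := by simp only [G.expected_r]; rfl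
    _ = _ := by
        refine integral_map hxm.aemeasurable ?_
        have h := G.measurable_gap.const_sub (⨆ y, G.rbar y G.mean)
        simp only [gap, sub_sub_cancel] at h
        exact h.aestronglyMeasurable

/-- Each action depends only on the past, so the regret equals the expected sum of gaps. Bounding it
as a lower integral spares integrability of the separate pieces. -/
theorem regret_le_of_lintegral_le [Nontrivial X] (hs : 0 < G.s) (ham : Measurable am)
    (ho : G.IsArgmaxOracle am) (hgap : ∀ x, G.gap x ≤ G.Rmax) (hθ : ∀ t, Measurable (θ t))
    (hp : ∀ t, P.map (θ t) = G.p) (hind : iIndepFun θ P) {T : ℕ}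
    (hint : ∀ t < T,
      Integrable (fun ω => G.r (G.pege2Action am T (fun i => θ i ω) t) (θ t ω)) P)
    {B : ℝ} (hB : 0 ≤ B)
    (h : ∫⁻ ω, ENNReal.ofReal (∑ t ∈ Finset.range T,
      G.gap (G.pege2Action am T (fun i => θ i ω) t)) ∂P ≤ ENNReal.ofReal B) :
    G.regret am P θ T ≤ B := by
  have hxm : ∀ t, Measurable fun ω => G.gap (G.pege2Action am T (fun i => θ i ω) t) := fun t =>
    G.measurable_gap.comp ((measurable_pege2Action hs ham ho T t).comp (measurable_seq hθ))
  have hgi : ∀ t, Integrable (fun ω => G.gap (G.pege2Action am T (fun i => θ i ω) t)) P := fun t =>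
    Integrable.of_bound (hxm t).aestronglyMeasurable G.Rmax (ae_of_all _ fun ω => by
      rw [Real.norm_of_nonneg (ho.gap_nonneg _)]; exact hgap _)
  have hV : (⨆ x, ∫ v, G.r x v ∂G.p) = ⨆ x, G.rbar x G.mean := by simp only [G.expected_r]; rfl
  have hreg : G.regret am P θ T =
      ∑ t ∈ Finset.range T, ∫ ω, G.gap (G.pege2Action am T (fun i => θ i ω) t) ∂P := by
    have h1 : ∀ t ∈ Finset.range T,
        ∫ ω, G.gap (G.pege2Action am T (fun i => θ i ω) t) ∂P = (⨆ x, G.rbar x G.mean) -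
          ∫ ω, G.r (G.pege2Action am T (fun i => θ i ω) t) (θ t ω) ∂P := by
      intro t ht
      rw [integral_reward_eq hθ hp hind (measurable_pege2Action hs ham ho T t)
        (fun _ _ => pege2Action_congr hs) (hint t (Finset.mem_range.1 ht))]
      have h2 : Integrable (fun ω => G.rbar (G.pege2Action am T (fun i => θ i ω) t) G.mean) P := by
        have := (integrable_const (μ := P) (⨆ x, G.rbar x G.mean)).sub (hgi t)
        refine this.congr (ae_of_all _ fun ω => ?_)
        simp [gap]
      simp only [gap]
      rw [integral_sub (integrable_const _) h2]
      simp
    rw [Finset.sum_congr rfl h1, Finset.sum_sub_distrib, regret, hV]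
    simp
  rw [hreg, ← integral_finsetSum _ fun t _ => hgi t]
  rw [← ofReal_integral_eq_lintegral_ofReal (integrable_finsetSum _ fun t _ => hgi t)
    (ae_of_all _ fun ω => Finset.sum_nonneg fun t _ => ho.gap_nonneg _)] at h
  exact (ENNReal.ofReal_le_ofReal_iff hB).1 h

/-! ### The regret of PEGE -/

variable (G) in
/-- The total gap of the actions of one exploration block. -/
def blockGap : ℝ := ∑ k, G.gap (G.σ k)

theorem IsArgmaxOracle.blockGap_nonneg (ho : G.IsArgmaxOracle am) : 0 ≤ G.blockGap :=
  Finset.sum_nonneg fun _ _ => ho.gap_nonneg _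

theorem blockGap_le (hgap : ∀ x, G.gap x ≤ G.Rmax) : G.blockGap ≤ G.s * G.Rmax := by
  refine (Finset.sum_le_card_nsmul _ _ _ fun k _ => hgap _).trans ?_
  simp

theorem sum_phase_eq (hs : 0 < G.s) (h : ℝ) (a₀ j : ℕ) (ϑ : ℕ → Vec n) :
    ∑ t ∈ Finset.Ico (G.phaseStart h a₀ j) (G.phaseStart h a₀ (j + 1)),
      G.gap (G.pegeAction am h a₀ ϑ t) =
    G.blockGap + ⌊Real.exp (h * ((j : ℝ) + 1))⌋₊ *
      G.gap (am (G.avgEst ϑ (G.phaseStart h a₀) (j + 1))) := by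
  have hidx : ∀ i < G.s + ⌊Real.exp (h * ((j : ℝ) + 1))⌋₊,
      G.phaseIndex h a₀ (G.phaseStart h a₀ j + i) = j := fun i hi =>
    phaseIndex_eq hs (Nat.le_add_right _ _) (by rw [phaseStart_succ]; omega)
  rw [Finset.sum_Ico_eq_sum_range, phaseStart_succ, Nat.add_sub_cancel_left, Finset.sum_range_add]
  congr 1
  · rw [Finset.sum_range, blockGap]
    refine Finset.sum_congr rfl fun k _ => ?_
    unfold pegeAction
    dsimp only
    rw [hidx k (by omega)]
    simp
  · rw [← nsmul_eq_mul]
    nth_rw 2 [← Finset.card_range ⌊Real.exp (h * ((j : ℝ) + 1))⌋₊]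
    rw [← Finset.sum_const]
    refine Finset.sum_congr rfl fun i hi => ?_
    unfold pegeAction
    dsimp only
    rw [hidx _ (by have := Finset.mem_range.1 hi; omega), dif_neg (by omega)]

theorem sum_phases_eq (hs : 0 < G.s) (h : ℝ) (a₀ J : ℕ) (ϑ : ℕ → Vec n) :
    ∑ t ∈ Finset.Ico a₀ (G.phaseStart h a₀ J), G.gap (G.pegeAction am h a₀ ϑ t) =
    ∑ j ∈ Finset.range J, (G.blockGap + ⌊Real.exp (h * ((j : ℝ) + 1))⌋₊ *
      G.gap (am (G.avgEst ϑ (G.phaseStart h a₀) (j + 1)))) := by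
  induction J with
  | zero => simp [phaseStart]
  | succ J ih =>
    rw [Finset.sum_range_succ, ← ih, ← sum_phase_eq hs,
      Finset.sum_Ico_consecutive _ (G.le_phaseStart h a₀ J)]
    rw [phaseStart_succ]; omega

theorem exists_phases (hs : 0 < G.s) {h : ℝ} (hh : 0 < h) (a₀ : ℕ) {T : ℕ} (hT : 1 ≤ T) :
    ∃ J : ℕ, T ≤ G.phaseStart h a₀ J ∧ (J : ℝ) ≤ 1 + Real.log T / h := by
  classical
  have hex : ∃ J, T ≤ G.phaseStart h a₀ J :=
    ⟨T, (Nat.le_add_left _ _).trans (G.add_le_phaseStart hs h a₀ T)⟩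
  have hT' : (1 : ℝ) ≤ T := by exact_mod_cast hT
  have hlog : 0 ≤ Real.log T / h := div_nonneg (Real.log_nonneg hT') hh.le
  refine ⟨Nat.find hex, Nat.find_spec hex, ?_⟩
  rcases hJ : Nat.find hex with _ | J
  · simp only [Nat.cast_zero]; linarith
  rcases J with _ | J
  · simp only [zero_add, Nat.cast_one]; linarith
  have hlt : ¬ T ≤ G.phaseStart h a₀ (J + 1) := Nat.find_min hex (by omega)
  -- By minimality, the phase before the last one ends before `T`, so its exploitation length bounds
  -- exp(h(J+1)) by `T`.
  rw [phaseStart_succ] at hlt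
  have h1 : ⌊Real.exp (h * ((J : ℝ) + 1))⌋₊ + 1 ≤ T := by omega
  have h2 : Real.exp (h * ((J : ℝ) + 1)) < T :=
    (Nat.lt_floor_add_one _).trans_le (by exact_mod_cast h1)
  have h3 : h * ((J : ℝ) + 1) < Real.log T := (Real.lt_log_iff_exp_lt (by linarith)).2 h2
  have h4 : (J : ℝ) + 1 < Real.log T / h := by rw [lt_div_iff₀ hh, mul_comm]; exact h3
  push_cast
  linarith

theorem sum_exp_neg_le {x : ℝ} (hx : 0 < x) (J : ℕ) :
    ∑ j ∈ Finset.range J, Real.exp (-(x * ((j : ℝ) + 1))) ≤ 1 / x := by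
  have h1 : ∀ j : ℕ, Real.exp (-(x * ((j : ℝ) + 1))) = Real.exp (-x) * Real.exp (-x) ^ j := by
    intro j
    rw [← Real.exp_nat_mul, ← Real.exp_add]
    congr 1; ring
  simp only [h1, ← Finset.mul_sum]
  set q := Real.exp (-x) with hq
  have hq0 : 0 < q := Real.exp_pos _
  have h2 : x * q ≤ 1 - q := by
    have := Real.add_one_le_exp x
    have h3 : Real.exp x * q = 1 := by rw [hq, ← Real.exp_add]; simp
    nlinarith
  have h4 : (∑ j ∈ Finset.range J, q ^ j) * (1 - q) = 1 - q ^ J := by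
    have := geom_sum_mul q J
    linarith
  have h5 : 0 ≤ ∑ j ∈ Finset.range J, q ^ j := Finset.sum_nonneg fun j _ => by positivity
  have h6 : 0 < q ^ J := by positivity
  rw [le_div_iff₀ hx]
  nlinarith

/-- The expected regret of PEGE with a parameter `h` at most `Δ² / (4 R² β²)`. -/
theorem lintegral_pege_le (hs : 0 < G.s) (hβ : 0 < G.betaσ) (ham : Measurable am)
    (ho : G.IsArgmaxOracle am) (hgap : ∀ x, G.gap x ≤ G.Rmax) (hθ : ∀ t, Measurable (θ t))
    (hp : ∀ t, P.map (θ t) = G.p) (hind : iIndepFun θ P) (hΔ : 0 < G.minGap) {h : ℝ} (hh : 0 < h)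
    (hle : h ≤ G.minGap ^ 2 / (G.R ^ 2 * G.betaσ ^ 2) / 4) (a₀ : ℕ) {T : ℕ} (hT : 1 ≤ T) :
    ∫⁻ ω, ENNReal.ofReal (∑ t ∈ Finset.Ico a₀ T,
      G.gap (G.pegeAction am h a₀ (fun i => θ i ω) t)) ∂P ≤
    ENNReal.ofReal ((1 + Real.log T / h) * G.blockGap +
      8 * G.Rmax / (G.minGap ^ 2 / (G.R ^ 2 * G.betaσ ^ 2))) := by
  have hR := G.R_pos
  set D := G.minGap ^ 2 / (G.R ^ 2 * G.betaσ ^ 2) with hD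
  have hDpos : 0 < D := by positivity
  have hRm : 0 ≤ G.Rmax := (ho.gap_nonneg (am 0)).trans (hgap _)
  obtain ⟨J, hJT, hJ⟩ := exists_phases hs hh a₀ hT
  let g : ℕ → Ω → ℝ := fun j ω =>
    G.gap (am (G.avgEst (fun i => θ i ω) (G.phaseStart h a₀) (j + 1)))
  have hg : ∀ j, Measurable (g j) := fun j =>
    G.measurable_gap.comp (ham.comp (G.measurable_avgEst (start := fun _ => G.phaseStart h a₀)
      (measurable_seq hθ) (fun _ => measurable_const) _))
  have hpath : ∀ ω, ∑ t ∈ Finset.Ico a₀ T, G.gap (G.pegeAction am h a₀ (fun i => θ i ω) t) ≤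
      J * G.blockGap + ∑ j ∈ Finset.range J, Real.exp (h * ((j : ℝ) + 1)) * g j ω := by
    intro ω
    calc _ ≤ ∑ t ∈ Finset.Ico a₀ (G.phaseStart h a₀ J),
            G.gap (G.pegeAction am h a₀ (fun i => θ i ω) t) :=
          Finset.sum_le_sum_of_subset_of_nonneg (Finset.Ico_subset_Ico_right hJT)
            fun _ _ _ => ho.gap_nonneg _
      _ = _ := sum_phases_eq hs h a₀ J _
      _ ≤ ∑ j ∈ Finset.range J, (G.blockGap + Real.exp (h * ((j : ℝ) + 1)) * g j ω) := by
          refine Finset.sum_le_sum fun j _ => add_le_add_right ?_ _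
          exact mul_le_mul_of_nonneg_right (Nat.floor_le (Real.exp_pos _).le) (ho.gap_nonneg _)
      _ = _ := by rw [Finset.sum_add_distrib]; simp
  have hterm : ∀ j : ℕ, ∫⁻ ω, ENNReal.ofReal (Real.exp (h * ((j : ℝ) + 1)) * g j ω) ∂P ≤
      ENNReal.ofReal (2 * G.Rmax * Real.exp (-(D / 4 * ((j : ℝ) + 1)))) := by
    intro j
    -- An error below Δ/2 makes the exploited action optimal. At γ = Δ/2 the tail exponent is D/2
    -- per block; since h ≤ D/4, a rate of at least D/4 survives the growth of the phases.
    set S := {ω | G.minGap / 2 ≤ G.R * ‖G.avgEst (fun i => θ i ω) (G.phaseStart h a₀) (j + 1) -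
      G.mean‖} with hS
    have hSm : MeasurableSet S := measurableSet_le measurable_const
      (((G.measurable_avgEst (start := fun _ => G.phaseStart h a₀)
      (measurable_seq hθ) (fun _ => measurable_const) _).sub_const _).norm.const_mul _)
    have hPS := G.measure_avgEst_ge_le hθ hp hind hβ
      (start := G.phaseStart h a₀) (fun i => G.phaseStart_add_le h a₀ (Nat.lt_succ_self i))
      (b := j + 1) (Nat.le_add_left _ _) (γ := G.minGap / 2) (by positivity)
    calc ∫⁻ ω, ENNReal.ofReal (Real.exp (h * ((j : ℝ) + 1)) * g j ω) ∂P
        ≤ ∫⁻ ω, S.indicator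
            (fun _ => ENNReal.ofReal (Real.exp (h * ((j : ℝ) + 1)) * G.Rmax)) ω ∂P := by
          refine lintegral_mono fun ω => ?_
          by_cases hω : ω ∈ S
          · rw [Set.indicator_of_mem hω]
            exact ENNReal.ofReal_le_ofReal
              (mul_le_mul_of_nonneg_left (hgap _) (Real.exp_pos _).le)
          · have : g j ω = 0 := ho.gap_argmax_eq_zero (not_le.1 hω)
            rw [this]; simp
      _ = ENNReal.ofReal (Real.exp (h * ((j : ℝ) + 1)) * G.Rmax) * P S := by
          rw [lintegral_indicator_const hSm]
      _ ≤ ENNReal.ofReal (Real.exp (h * ((j : ℝ) + 1)) * G.Rmax) * _ :=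
          mul_le_mul_right hPS _
      _ ≤ _ := by
          rw [← ENNReal.ofReal_mul (by positivity)]
          refine ENNReal.ofReal_le_ofReal ?_
          have e1 : 2 * ((j + 1 : ℕ) : ℝ) * (G.minGap / 2) ^ 2 / (G.R ^ 2 * G.betaσ ^ 2) =
              D / 2 * ((j : ℝ) + 1) := by
            rw [hD]; push_cast; field_simp
          rw [e1]
          have e2 : Real.exp (h * ((j : ℝ) + 1)) * G.Rmax *
              (2 * Real.exp (-(D / 2 * ((j : ℝ) + 1)))) = 2 * G.Rmax *
              Real.exp (h * ((j : ℝ) + 1) + -(D / 2 * ((j : ℝ) + 1))) := by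
            rw [Real.exp_add]; ring
          rw [e2]
          refine mul_le_mul_of_nonneg_left (Real.exp_le_exp.2 ?_) (by positivity)
          have : 0 ≤ (D / 4 - h) * ((j : ℝ) + 1) :=
            mul_nonneg (by linarith) (by positivity)
          linarith
  have hb := ho.blockGap_nonneg
  calc _ ≤ ∫⁻ ω, ENNReal.ofReal (J * G.blockGap) +
          ∑ j ∈ Finset.range J, ENNReal.ofReal (Real.exp (h * ((j : ℝ) + 1)) * g j ω) ∂P := by
        refine lintegral_mono fun ω => (ENNReal.ofReal_le_ofReal (hpath ω)).trans ?_
        rw [← ENNReal.ofReal_sum_of_nonneg fun j _ =>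
          mul_nonneg (Real.exp_pos _).le (ho.gap_nonneg _)]
        exact ENNReal.ofReal_add_le
    _ = ENNReal.ofReal (J * G.blockGap) + ∑ j ∈ Finset.range J,
          ∫⁻ ω, ENNReal.ofReal (Real.exp (h * ((j : ℝ) + 1)) * g j ω) ∂P := by
        rw [lintegral_add_left measurable_const, lintegral_const, measure_univ, mul_one,
          lintegral_finsetSum _ fun j _ => ((hg j).const_mul _).ennreal_ofReal]
    _ ≤ ENNReal.ofReal (J * G.blockGap) + ∑ j ∈ Finset.range J,
          ENNReal.ofReal (2 * G.Rmax * Real.exp (-(D / 4 * ((j : ℝ) + 1)))) := by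
        gcongr with j _
        exact hterm j
    _ ≤ _ := by
        rw [← ENNReal.ofReal_sum_of_nonneg fun j _ => by positivity,
          ← ENNReal.ofReal_add (by positivity)
            (Finset.sum_nonneg fun j _ => by positivity)]
        refine ENNReal.ofReal_le_ofReal (add_le_add (mul_le_mul_of_nonneg_right hJ hb) ?_)
        rw [← Finset.mul_sum]
        refine (mul_le_mul_of_nonneg_left (sum_exp_neg_le (by positivity) J)
          (by positivity)).trans (le_of_eq ?_)
        field_simp; ring

end CPMGame
end

/-! ### Elementary estimates -/

theorem sum_inv_sq_le (N : ℕ) : ∑ i ∈ Finset.range N, (((i + 1 : ℕ) : ℝ) ^ 2)⁻¹ ≤ 2 := by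
  -- The stronger bound telescopes; at N = 0 the term 1/N is 0.
  suffices h : ∑ i ∈ Finset.range N, (((i + 1 : ℕ) : ℝ) ^ 2)⁻¹ ≤ 2 - 1 / (N : ℝ) by
    have : 0 ≤ 1 / (N : ℝ) := by positivity
    linarith
  induction N with
  | zero => norm_num
  | succ N ih =>
    rw [Finset.sum_range_succ]
    rcases N.eq_zero_or_pos with rfl | hN
    · norm_num
    have hN' : (0 : ℝ) < N := by exact_mod_cast hN
    have h : (((N + 1 : ℕ) : ℝ) ^ 2)⁻¹ ≤ 1 / (N : ℝ) - 1 / ((N + 1 : ℕ) : ℝ) := by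
      push_cast
      rw [div_sub_div _ _ (by positivity) (by positivity), inv_eq_one_div,
        div_le_div_iff₀ (by positivity) (by positivity)]
      nlinarith
    linarith

/-- The logarithm at `y` is at least 2, so yD ≥ 128. Beyond `y` the right side therefore has slope D
≥ 128/y, which dominates the growth 128 log(b/y) of the left. -/
theorem log_confidence_mono {T D y b : ℝ} (hT : 1 ≤ T) (hy : 1 ≤ y) (hyb : y ≤ b)
    (h : 64 * Real.log (4 * Real.exp 1 ^ 2 * y ^ 2 * T) ≤ y * D) :
    64 * Real.log (4 * Real.exp 1 ^ 2 * b ^ 2 * T) ≤ b * D := by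
  have hy0 : 0 < y := by linarith
  have hb0 : 0 < b := by linarith
  have hT0 : 0 < T := by linarith
  have h1 : Real.log (4 * Real.exp 1 ^ 2 * b ^ 2 * T) =
      Real.log (4 * Real.exp 1 ^ 2 * y ^ 2 * T) + 2 * Real.log (b / y) := by
    rw [show 4 * Real.exp 1 ^ 2 * b ^ 2 * T = 4 * Real.exp 1 ^ 2 * y ^ 2 * T * (b / y) ^ 2 by
      field_simp, Real.log_mul (by positivity) (by positivity), Real.log_pow]
    push_cast; ring
  have h2 : Real.log (b / y) ≤ b / y - 1 := Real.log_le_sub_one_of_pos (by positivity)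
  have h3 : 2 ≤ Real.log (4 * Real.exp 1 ^ 2 * y ^ 2 * T) := by
    rw [Real.le_log_iff_exp_le (by positivity)]
    rw [show Real.exp 2 = Real.exp 1 ^ 2 by rw [← Real.exp_nat_mul]; norm_num]
    have h5 : 1 ≤ y ^ 2 := one_le_pow₀ hy
    have h6 : 1 ≤ y ^ 2 * T := by nlinarith
    have h7 : 0 < Real.exp 1 ^ 2 := by positivity
    nlinarith
  have h4 : b / y - 1 = (b - y) / y := by field_simp
  have h5 : 128 * ((b - y) / y) ≤ (b - y) * D := by
    rw [mul_div_assoc', div_le_iff₀ hy0]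
    nlinarith [mul_nonneg (sub_nonneg.2 hyb) (show 0 ≤ y * D - 128 by linarith)]
  rw [h1]
  nlinarith

/-- With z the argument of the logarithm in T₁, T₁D/2 = 128 log z, so the claim is 4e²(T₁/2)²T ≤ z².
As T₁ = z log z / (2e²T), this amounts to log z ≤ 2e√T, which holds because D ≥ 9 gives z ≤ 64e²T.
-/
theorem log_confidence_half {T D T₁ : ℝ} (hT : 2 ≤ T) (hD : 0 < D) (hB : 9 ≤ D)
    (hT₁ : T₁ = 256 / D * Real.log (512 * Real.exp 1 ^ 2 * T / D))
    (hz0 : 0 < 512 * Real.exp 1 ^ 2 * T / D)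
    (hlz : 0 < Real.log (512 * Real.exp 1 ^ 2 * T / D)) :
    64 * Real.log (4 * Real.exp 1 ^ 2 * (T₁ / 2) ^ 2 * T) ≤ T₁ / 2 * D := by
  have hT0 : 0 < T := by linarith
  have he := Real.exp_one_gt_d9
  have he7 : 7 ≤ Real.exp 1 ^ 2 := by nlinarith
  have hlog2 := Real.log_two_gt_d9
  have hlog2' := Real.log_two_lt_d9
  have hlexp : Real.log (Real.exp 1 ^ 2) = 2 := by rw [Real.log_pow, Real.log_exp]; norm_num
  set z := 512 * Real.exp 1 ^ 2 * T / D with hz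
  have hT₁D : T₁ * D = 256 * Real.log z := by rw [hT₁]; field_simp
  have hT₁0 : 0 < T₁ := by rw [hT₁]; positivity
  have hroot : Real.log z ≤ 2 * Real.exp 1 * Real.sqrt T := by
    have h1 : z ≤ 64 * Real.exp 1 ^ 2 * T := by
      rw [hz, div_le_iff₀ hD]
      have : 0 < Real.exp 1 ^ 2 * T := by positivity
      nlinarith
    have h2 := Real.log_le_log hz0 h1
    rw [Real.log_mul (by positivity) (by positivity), Real.log_mul (by norm_num)
      (by positivity), hlexp, show (64 : ℝ) = 2 ^ 6 by norm_num, Real.log_pow] at h2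
    push_cast at h2
    have h3 : Real.log T = 2 * Real.log (Real.sqrt T) := by
      rw [Real.log_sqrt hT0.le]; ring
    have hu : 1.4 ≤ Real.sqrt T := Real.le_sqrt_of_sq_le (by linarith)
    have h4 : Real.log (Real.sqrt T) ≤ Real.sqrt T - 1 :=
      Real.log_le_sub_one_of_pos (by linarith)
    nlinarith
  have hbound : 4 * Real.exp 1 ^ 2 * (T₁ / 2) ^ 2 * T ≤ z ^ 2 := by
    have h1 : T₁ = z * Real.log z / (2 * Real.exp 1 ^ 2 * T) := by
      rw [hT₁, hz]; field_simp; ring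
    have h2 : 4 * Real.exp 1 ^ 2 * (T₁ / 2) ^ 2 * T =
        z ^ 2 * (Real.log z ^ 2 / (4 * Real.exp 1 ^ 2 * T)) := by
      rw [h1]; field_simp; ring
    rw [h2]
    refine mul_le_of_le_one_right (by positivity) (div_le_one_of_le₀ ?_ (by positivity))
    have h3 := pow_le_pow_left₀ hlz.le hroot 2
    rw [mul_pow, mul_pow, Real.sq_sqrt hT0.le] at h3
    linarith
  have h5 := Real.log_le_log (by positivity) hbound
  rw [Real.log_pow] at h5
  push_cast at h5
  linarith

/-- Here 5/8 · 256 = 64 · 5/2, so the argument on the left has to be at most z^(5/2). Writing z = q⁴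
reduces this to log q ≤ q. -/
theorem log_confidence_five_eighths {T D T₁ : ℝ} (hT : 2 ≤ T) (hD : 0 < D)
    (hT₁ : T₁ = 256 / D * Real.log (512 * Real.exp 1 ^ 2 * T / D))
    (hz0 : 0 < 512 * Real.exp 1 ^ 2 * T / D)
    (hlz : 0 < Real.log (512 * Real.exp 1 ^ 2 * T / D)) :
    64 * Real.log (4 * Real.exp 1 ^ 2 * (5 / 8 * T₁) ^ 2 * T) ≤ 5 / 8 * T₁ * D := by
  have hT0 : 0 < T := by linarith
  have he := Real.exp_one_gt_d9
  have he7 : 7 ≤ Real.exp 1 ^ 2 := by nlinarith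
  set z := 512 * Real.exp 1 ^ 2 * T / D with hz
  have hT₁D : T₁ * D = 256 * Real.log z := by rw [hT₁]; field_simp
  have hT₁0 : 0 < T₁ := by rw [hT₁]; positivity
  set q := z ^ (1 / 4 : ℝ) with hq
  have hq0 : 0 < q := by positivity
  have hqz : z = q ^ 4 := by
    rw [hq, ← Real.rpow_natCast, ← Real.rpow_mul hz0.le]; norm_num
  have hlq : Real.log z = 4 * Real.log q := by rw [hqz, Real.log_pow]; norm_num
  have hlq' : Real.log q ≤ q := (Real.log_le_sub_one_of_pos hq0).trans (by linarith)
  have hbound : 4 * Real.exp 1 ^ 2 * (5 / 8 * T₁) ^ 2 * T ≤ q ^ 10 := by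
    have h1 : T₁ = z * Real.log z / (2 * Real.exp 1 ^ 2 * T) := by
      rw [hT₁, hz]; field_simp; ring
    have h2 : 4 * Real.exp 1 ^ 2 * (5 / 8 * T₁) ^ 2 * T =
        q ^ 8 * (25 * Real.log q ^ 2 / (4 * Real.exp 1 ^ 2 * T)) := by
      have aux : ∀ E l w : ℝ, 0 < E → 4 * E * (5 / 8 * (w * (4 * l) / (2 * E * T))) ^ 2 * T =
          w ^ 2 * (25 * l ^ 2 / (4 * E * T)) := by
        intro E l w hE
        field_simp
        ring
      rw [h1, hlq, aux _ _ _ (by positivity)]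
      congr 1
      rw [hqz]; ring
    rw [h2, show q ^ 10 = q ^ 8 * q ^ 2 by ring]
    refine mul_le_mul_of_nonneg_left ?_ (by positivity)
    rw [div_le_iff₀ (by positivity)]
    have h3 := pow_le_pow_left₀ (by linarith) hlq' 2
    have h4 : 14 ≤ Real.exp 1 ^ 2 * T := by nlinarith
    have h5 : q ^ 2 * 56 ≤ q ^ 2 * (4 * Real.exp 1 ^ 2 * T) := by gcongr; linarith
    linarith [sq_nonneg q]
  have h5 := Real.log_le_log (by positivity) hbound
  rw [Real.log_pow] at h5
  push_cast at h5
  linarith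

/-- Some number of episodes makes the confidence width an eighth of the gap, with enough slack
below `T₁` to absorb the lower order terms of the regret. -/
theorem exists_episodes {T D : ℝ} (hT : 2 ≤ T) (hD : 0 < D) {T₁ : ℝ}
    (hT₁ : T₁ = 256 / D * Real.log (512 * Real.exp 1 ^ 2 * T / D)) :
    ∃ b : ℕ, 1 ≤ b ∧ (b : ℝ) ≤ max T₁ 1 ∧
      64 * Real.log (4 * Real.exp 1 ^ 2 * (b : ℝ) ^ 2 * T) ≤ b * D ∧
      ∀ s : ℝ, 1 ≤ s → (b + 1) * s + 8 / D + 1 / 32 ≤ max T₁ 2 * s + 1 := by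
  have hT0 : 0 < T := by linarith
  have he := Real.exp_one_gt_d9
  have he7 : 7 ≤ Real.exp 1 ^ 2 := by nlinarith
  have hlog2 := Real.log_two_gt_d9
  have hlog2' := Real.log_two_lt_d9
  have hlexp : Real.log (Real.exp 1 ^ 2) = 2 := by rw [Real.log_pow, Real.log_exp]; norm_num
  set L := Real.log (4 * Real.exp 1 ^ 2 * T) with hL
  have hLval : L = 2 * Real.log 2 + 2 + Real.log T := by
    rw [hL, Real.log_mul (by positivity) (by positivity), Real.log_mul (by norm_num)
      (by positivity), hlexp, show (4 : ℝ) = 2 ^ 2 by norm_num, Real.log_pow]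
    push_cast; ring
  have hlogT : Real.log 2 ≤ Real.log T := Real.log_le_log (by norm_num) hT
  have hL4 : 4 ≤ L := by rw [hLval]; linarith
  set z := 512 * Real.exp 1 ^ 2 * T / D with hz
  have hz0 : 0 < z := by positivity
  have hzD : z * D = 512 * Real.exp 1 ^ 2 * T := by rw [hz]; field_simp
  have hT₁D : T₁ * D = 256 * Real.log z := by rw [hT₁]; field_simp
  -- Three regimes. For large D one episode suffices, and the 2 in the maximum pays for it. For
  -- intermediate D, ⌊T₁⌋ - 1 episodes leave one block spare. For D < 9 the term 8/D can be large,
  -- and only a fixed fraction of T₁ is used.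
  rcases le_or_gt (64 * L) D with hA | hA
  · refine ⟨1, le_rfl, by simp, by rw [Nat.cast_one, one_pow, mul_one, one_mul]; exact hA,
      fun s hs => ?_⟩
    have h1 : 8 / D ≤ 1 / 32 := by rw [div_le_div_iff₀ hD (by norm_num)]; linarith
    have h2 : 2 * s ≤ max T₁ 2 * s := by gcongr; exact le_max_right _ _
    push_cast
    linarith
  rcases le_or_gt 9 D with hB | hC
  -- From D < 64L, log z ≥ L + log 2 - log L; the tangent of log at 2e bounds log L by L/5 + log 2.
  · have hlogz : 4 / 5 * L ≤ Real.log z := by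
      have h1 : 8 * Real.exp 1 ^ 2 * T / L ≤ z := by
        rw [hz, div_le_div_iff₀ (by linarith) hD]
        have : 0 < Real.exp 1 ^ 2 * T := by positivity
        nlinarith
      have h2 := Real.log_le_log (by positivity) h1
      have h3 : Real.log (8 * Real.exp 1 ^ 2 * T / L) =
          L + Real.log 2 - Real.log L := by
        rw [Real.log_div (by positivity) (by linarith),
          show 8 * Real.exp 1 ^ 2 * T = 4 * Real.exp 1 ^ 2 * T * 2 by ring,
          Real.log_mul (by positivity) (by norm_num)]
      have h4 : Real.log (L / (2 * Real.exp 1)) ≤ L / (2 * Real.exp 1) - 1 :=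
        Real.log_le_sub_one_of_pos (by positivity)
      rw [Real.log_div (by linarith) (by positivity), Real.log_mul (by norm_num) (by positivity),
        Real.log_exp] at h4
      have h5 : L / (2 * Real.exp 1) ≤ L / 5 := by
        gcongr; linarith
      linarith
    have hT3 : 3 ≤ T₁ := by
      by_contra! hc
      nlinarith
    have hf1 : (⌊T₁⌋₊ : ℝ) ≤ T₁ := Nat.floor_le (by linarith)
    have hf2 : T₁ < ⌊T₁⌋₊ + 1 := Nat.lt_floor_add_one T₁
    have hf3 : 3 ≤ ⌊T₁⌋₊ := Nat.le_floor (by exact_mod_cast hT3)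
    obtain ⟨b, hb⟩ : ∃ b, ⌊T₁⌋₊ = b + 1 := ⟨⌊T₁⌋₊ - 1, by omega⟩
    rw [hb] at hf1 hf2 hf3
    push_cast at hf1 hf2
    have hb2 : (2 : ℝ) ≤ b := by exact_mod_cast (by omega : 2 ≤ b)
    refine ⟨b, by omega, le_max_of_le_left (by linarith), ?_, fun s hs => ?_⟩
    · have hhalf : T₁ / 2 ≤ b := by
        rcases le_or_gt T₁ 4 with h4 | h4 <;> linarith
      refine log_confidence_mono (by linarith) (by linarith) hhalf ?_
      exact log_confidence_half hT hD hB hT₁ hz0 (by linarith)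
    · have h1 : 8 / D ≤ 8 / 9 := by gcongr
      have h2 : (b + 1) * s ≤ max T₁ 2 * s := by
        gcongr
        exact le_max_of_le_left (by linarith)
      linarith
  · have hlogz : 4 ≤ Real.log z := by
      have h1 : (2 : ℝ) ^ 6 ≤ z := by
        rw [hz, le_div_iff₀ hD]
        have : 14 ≤ Real.exp 1 ^ 2 * T := by nlinarith
        nlinarith
      have h2 := Real.log_le_log (by norm_num) h1
      rw [Real.log_pow] at h2
      push_cast at h2
      linarith
    have hT100 : 100 ≤ T₁ := by
      by_contra! hc
      nlinarith
    have hy : 1 ≤ 5 / 8 * T₁ := by linarith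
    have hceil : (⌈5 / 8 * T₁⌉₊ : ℝ) < 5 / 8 * T₁ + 1 := Nat.ceil_lt_add_one (by linarith)
    -- Equivalent to T₁D ≥ 1024, which is 256 log z with log z ≥ 4.
    have h8 : 8 / D ≤ T₁ / 128 := by
      rw [div_le_div_iff₀ hD (by norm_num)]
      linarith
    refine ⟨⌈5 / 8 * T₁⌉₊, Nat.one_le_ceil_iff.2 (by linarith), le_max_of_le_left (by linarith),
      ?_, fun s hs => ?_⟩
    · refine log_confidence_mono (by linarith) hy (Nat.le_ceil _) ?_
      have hlz : 0 < Real.log z := by linarith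
      exact log_confidence_five_eighths hT hD hT₁ hz0 hlz
    · have h2 : (5 / 8 * T₁ + 2 + T₁ / 128) * s ≤ max T₁ 2 * s := by
        gcongr
        exact le_max_of_le_left (by linarith)
      have h3 : 8 / D ≤ T₁ / 128 * s := h8.trans (le_mul_of_one_le_right (by linarith) hs)
      have h4 : (⌈5 / 8 * T₁⌉₊ + 1 : ℝ) * s ≤ (5 / 8 * T₁ + 2) * s :=
        mul_le_mul_of_nonneg_right (by linarith) (by linarith)
      nlinarith

theorem sqrt_log_cube_le {T : ℝ} (hT : 2 ≤ T) :
    2 ≤ Real.sqrt (Real.log (4 * Real.exp 1 ^ 2 * T ^ 3)) ∧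
      Real.sqrt (Real.log (4 * Real.exp 1 ^ 2 * T ^ 3)) ≤ 8 * Real.log T := by
  have hlog2 := Real.log_two_gt_d9
  have hlog2' := Real.log_two_lt_d9
  have hlogT : Real.log 2 ≤ Real.log T := Real.log_le_log (by norm_num) hT
  have h : Real.log (4 * Real.exp 1 ^ 2 * T ^ 3) = 2 * Real.log 2 + 2 + 3 * Real.log T := by
    rw [Real.log_mul (by positivity) (by positivity), Real.log_mul (by norm_num)
      (by positivity), Real.log_pow, Real.log_exp, Real.log_pow,
      show (4 : ℝ) = 2 ^ 2 by norm_num, Real.log_pow]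
    push_cast; ring
  rw [h]
  refine ⟨Real.le_sqrt_of_sq_le (by linarith), Real.sqrt_le_iff.2 ⟨by linarith, ?_⟩⟩
  nlinarith

noncomputable section
namespace CPMGame

variable {n : ℕ} {X : Type*} [MeasurableSpace X] {G : CPMGame n X} {am : Vec n → X}
  {Ω : Type*} [MeasurableSpace Ω] {P : Measure Ω} [IsProbabilityMeasure P] {θ : ℕ → Ω → Vec n}

/-! ### The regret of PEGE2 -/

variable (G) in
/-- The error of the estimated rewards after `b` episodes of gap estimation. -/
def estError (b : ℕ) (ϑ : ℕ → Vec n) : ℝ := G.R * ‖G.avgEst ϑ (fun i => i * G.s) b - G.mean‖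

theorem measurable_estError (b : ℕ) : Measurable (G.estError b) :=
  (((G.measurable_avgEst_mul b).sub_const _).norm).const_mul _

theorem width_sq {T b : ℕ} (hT : 1 ≤ T) (hb : 1 ≤ b) :
    G.width (1 / T) b ^ 2 =
      G.R ^ 2 * G.betaσ ^ 2 * Real.log (4 * Real.exp 1 ^ 2 * (b : ℝ) ^ 2 * T) / b := by
  have hT' : (1 : ℝ) ≤ T := by exact_mod_cast hT
  have hb' : (1 : ℝ) ≤ b := by exact_mod_cast hb
  have he := Real.exp_one_gt_d9
  have h1 : (1 : ℝ) ≤ 4 * Real.exp 1 ^ 2 * (b : ℝ) ^ 2 * T := by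
    have : (1 : ℝ) ≤ Real.exp 1 ^ 2 := one_le_pow₀ (by linarith)
    have h2 : (1 : ℝ) ≤ (b : ℝ) ^ 2 := one_le_pow₀ hb'
    have h3 : (1 : ℝ) ≤ Real.exp 1 ^ 2 * (b : ℝ) ^ 2 := one_le_mul_of_one_le_of_one_le this h2
    nlinarith
  have h2 := Real.log_nonneg h1
  rw [width, one_div, div_inv_eq_mul, Real.sq_sqrt (by positivity)]

theorem measure_width_le_estError_le (hβ : 0 < G.betaσ) (hθ : ∀ t, Measurable (θ t))
    (hp : ∀ t, P.map (θ t) = G.p) (hind : iIndepFun θ P) {T b : ℕ} (hT : 1 ≤ T) (hb : 1 ≤ b) :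
    P {ω | G.width (1 / T) b ≤ G.estError b fun i => θ i ω} ≤
      ENNReal.ofReal (1 / (64 * T) * ((b : ℝ) ^ 2)⁻¹) := by
  have hR := G.R_pos
  have hT' : (1 : ℝ) ≤ T := by exact_mod_cast hT
  have hb' : (1 : ℝ) ≤ b := by exact_mod_cast hb
  refine (G.measure_avgEst_ge_le hθ hp hind hβ (start := fun i => i * G.s)
    (fun i => (Nat.succ_mul i G.s).ge) hb (width_nonneg _ _)).trans (ENNReal.ofReal_le_ofReal ?_)
  rw [width_sq hT hb]
  set z := 4 * Real.exp 1 ^ 2 * (b : ℝ) ^ 2 * T with hz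
  have hz0 : 0 < z := by positivity
  -- At γ = w(b) the tail bound is exactly 2/z² with z = 4e²b²T.
  have h1 : -(2 * b * (G.R ^ 2 * G.betaσ ^ 2 * Real.log z / b) / (G.R ^ 2 * G.betaσ ^ 2)) =
      Real.log ((z ^ 2)⁻¹) := by
    rw [Real.log_inv, Real.log_pow]; push_cast; field_simp
  rw [h1, Real.exp_log (by positivity)]
  have he := Real.exp_one_gt_d9
  have he4 : 8 ≤ Real.exp 1 ^ 4 := by
    have := pow_le_pow_left₀ (by norm_num) (show (2 : ℝ) ≤ Real.exp 1 by linarith) 4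
    linarith
  rw [← div_eq_mul_inv, ← div_eq_mul_inv, div_div,
    div_le_div_iff₀ (by positivity) (by positivity), hz]
  have h2 : (1 : ℝ) ≤ (b : ℝ) ^ 2 * T :=
    one_le_mul_of_one_le_of_one_le (one_le_pow₀ hb') hT'
  have h3 : 8 * 1 ≤ Real.exp 1 ^ 4 * ((b : ℝ) ^ 2 * T) :=
    mul_le_mul he4 h2 (by norm_num) (by positivity)
  have h4 : 0 < (b : ℝ) ^ 2 * T := by positivity
  nlinarith

theorem measure_exists_width_le_le (hβ : 0 < G.betaσ) (hθ : ∀ t, Measurable (θ t))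
    (hp : ∀ t, P.map (θ t) = G.p) (hind : iIndepFun θ P) {T : ℕ} (hT : 1 ≤ T) (N : ℕ) :
    P {ω | ∃ b, 1 ≤ b ∧ b ≤ N ∧ G.width (1 / T) b ≤ G.estError b fun i => θ i ω} ≤
      ENNReal.ofReal (1 / (32 * T)) := by
  have hsub : {ω | ∃ b, 1 ≤ b ∧ b ≤ N ∧ G.width (1 / T) b ≤ G.estError b fun i => θ i ω} ⊆
      ⋃ i ∈ Finset.range N,
        {ω | G.width (1 / T) (i + 1) ≤ G.estError (i + 1) fun j => θ j ω} := by
    rintro ω ⟨b, h1, h2, h3⟩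
    obtain ⟨i, rfl⟩ : ∃ i, b = i + 1 := ⟨b - 1, by omega⟩
    exact Set.mem_biUnion (Finset.mem_coe.2 (Finset.mem_range.2 h2)) h3
  calc _ ≤ ∑ i ∈ Finset.range N,
          P {ω | G.width (1 / T) (i + 1) ≤ G.estError (i + 1) fun j => θ j ω} :=
        (measure_mono hsub).trans (measure_biUnion_finset_le _ _)
    _ ≤ ∑ i ∈ Finset.range N,
          ENNReal.ofReal (1 / (64 * T) * (((i + 1 : ℕ) : ℝ) ^ 2)⁻¹) :=
        Finset.sum_le_sum fun i _ =>
          measure_width_le_estError_le hβ hθ hp hind hT (Nat.le_add_left 1 i)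
    _ = ENNReal.ofReal (1 / (64 * T) * ∑ i ∈ Finset.range N, (((i + 1 : ℕ) : ℝ) ^ 2)⁻¹) := by
        rw [Finset.mul_sum, ENNReal.ofReal_sum_of_nonneg fun i _ => by positivity]
    _ ≤ _ := by
        refine ENNReal.ofReal_le_ofReal ?_
        refine (mul_le_mul_of_nonneg_left (sum_inv_sq_le N) (by positivity)).trans (le_of_eq ?_)
        have : (T : ℝ) ≠ 0 := by positivity
        field_simp; norm_num

/-- The parameter that PEGE2 passes to PEGE after `b` episodes of gap estimation. -/
def pegeParam (G : CPMGame n X) (am : Vec n → X) (b : ℕ) (ϑ : ℕ → Vec n) : ℝ :=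
  G.estGap am (G.avgEst ϑ (fun i => i * G.s) b) ^ 2 / (9 * G.R ^ 2 * G.betaσ ^ 2)

/-- The gap estimation stops with a gap after `b` episodes and the estimate is accurate. -/
def foundSet (G : CPMGame n X) (am : Vec n → X) (T b : ℕ) : Set (ℕ → Vec n) :=
  {ϑ | G.gapEpisodes am (G.T₀ T) (1 / T) ϑ = b ∧ G.GapFound am (1 / T) ϑ b ∧
    G.estError b ϑ < G.width (1 / T) b}

theorem measurableSet_foundSet [Nontrivial X] (ho : G.IsArgmaxOracle am) (T b : ℕ) :
    MeasurableSet (foundSet G am T b) :=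
  (measurable_gapEpisodes ho _ _ (measurableSet_singleton b)).inter
    ((measurableSet_gapFound ho _ b).inter
      (measurableSet_lt (measurable_estError b) measurable_const))

/-- `foundSet` asks for accuracy at episode `b` only: requiring it at later episodes too would
involve outcomes that PEGE uses, and independence would be lost. -/
theorem mem_foundSet_congr {T b : ℕ} {ϑ ϑ' : ℕ → Vec n} (h : ∀ i < b * G.s, ϑ i = ϑ' i)
    (hϑ : ϑ ∈ foundSet G am T b) : ϑ' ∈ foundSet G am T b := by
  obtain ⟨h1, h2, h3⟩ := hϑ
  refine ⟨?_, (gapFound_congr h).1 h2, ?_⟩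
  · rw [gapEpisodes_congr (ϑ := ϑ) (by rwa [h1]), h1]
  · rwa [estError, ← avgEst_mul_congr h]

theorem measurable_pegeParam [Nontrivial X] (ho : G.IsArgmaxOracle am) (b : ℕ) :
    Measurable (pegeParam G am b) :=
  ((ho.continuous_estGap.measurable.comp (G.measurable_avgEst_mul b)).pow_const 2).div_const _

theorem measurable_sum_gap_pegeAction {α : Type*} [MeasurableSpace α] (hs : 0 < G.s)
    (ham : Measurable am) {h : α → ℝ} {v : α → ℕ → Vec n} (hh : Measurable h) (hv : Measurable v)
    (a₀ : ℕ) (S : Finset ℕ) :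
    Measurable fun a => ∑ t ∈ S, G.gap (G.pegeAction am (h a) a₀ (v a) t) := by
  have h1 : ∀ t, Measurable fun a => G.gap (G.pegeAction am (h a) a₀ (v a) t) := by
    intro t
    have h2 := (measurable_pegeAction hs ham a₀ t).comp (hh.prodMk hv)
    exact G.measurable_gap.comp h2
  exact Finset.measurable_sum _ fun t _ => h1 t

/-- The regret of the PEGE phase, on the event that the gap estimation ends after `b` episodes. -/
theorem lintegral_foundSet_le [Nontrivial X] (hs : 0 < G.s) (hβ : 0 < G.betaσ)
    (ham : Measurable am) (ho : G.IsArgmaxOracle am) (hgap : ∀ x, G.gap x ≤ G.Rmax)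
    (hθ : ∀ t, Measurable (θ t)) (hp : ∀ t, P.map (θ t) = G.p) (hind : iIndepFun θ P) {T : ℕ}
    (hT : 1 ≤ T) {K : ℝ} {b : ℕ}
    (hK : ∀ ϑ ∈ foundSet G am T b, 0 < G.minGap ∧ 0 < pegeParam G am b ϑ ∧
      pegeParam G am b ϑ ≤ G.minGap ^ 2 / (G.R ^ 2 * G.betaσ ^ 2) / 4 ∧
      (1 + Real.log T / pegeParam G am b ϑ) * G.blockGap +
        8 * G.Rmax / (G.minGap ^ 2 / (G.R ^ 2 * G.betaσ ^ 2)) ≤ K) :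
    ∫⁻ ω, (foundSet G am T b).indicator (fun ϑ => ENNReal.ofReal (∑ t ∈ Finset.Ico (b * G.s) T,
        G.gap (G.pegeAction am (pegeParam G am b ϑ) (b * G.s) ϑ t))) (fun i => θ i ω) ∂P ≤
      ENNReal.ofReal K * P {ω | (fun i => θ i ω) ∈ foundSet G am T b} := by
  classical
  set E := foundSet G am T b with hE
  have hEm : MeasurableSet E := measurableSet_foundSet ho T b
  -- `A` carries the outcomes of gap estimation, which fix the event and the parameter; `B` carries
  -- those seen by PEGE. Once `A` is frozen, the bound for deterministic `h` applies.
  set A : Ω → ℕ → Vec n := fun ω => restrictSeq (Finset.range (b * G.s)) fun i => θ i ω with hA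
  set B : Ω → ℕ → Vec n := fun ω => restrictSeq (Finset.Ico (b * G.s) T) fun i => θ i ω with hB
  have hAm : Measurable A := (measurable_restrictSeq _).comp (measurable_seq hθ)
  have hBm : Measurable B := (measurable_restrictSeq _).comp (measurable_seq hθ)
  have hAB : IndepFun A B P := indepFun_restrictSeq hθ hind (by
    rw [Finset.disjoint_left]
    intro i hi hi'
    rw [Finset.mem_range] at hi
    rw [Finset.mem_Ico] at hi'
    omega)
  have hAeq : ∀ ω, ∀ i < b * G.s, A ω i = θ i ω := fun ω i hi =>
    restrictSeq_of_mem (u := fun i => θ i ω) (Finset.mem_range.2 hi)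
  have hBeq : ∀ ω, ∀ i, b * G.s ≤ i → i < T → B ω i = θ i ω := fun ω i hi hi' =>
    restrictSeq_of_mem (u := fun i => θ i ω) (Finset.mem_Ico.2 ⟨hi, hi'⟩)
  let F : ℝ → (ℕ → Vec n) → ENNReal := fun h v => ENNReal.ofReal (∑ t ∈ Finset.Ico (b * G.s) T,
    G.gap (G.pegeAction am h (b * G.s) v t))
  have hFB : ∀ h ω, F h (B ω) = F h fun i => θ i ω := by
    intro h ω
    refine congrArg ENNReal.ofReal (Finset.sum_congr rfl fun t ht => ?_)
    rw [pegeAction_congr hs fun i hi hi' => hBeq ω i hi (hi'.trans (Finset.mem_Ico.1 ht).2)]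
  let f : (ℕ → Vec n) → (ℕ → Vec n) → ENNReal := fun u v =>
    if u ∈ E then F (pegeParam G am b u) v else 0
  have hfm : Measurable (Function.uncurry f) := by
    have h1 : Measurable fun q : (ℕ → Vec n) × (ℕ → Vec n) => pegeParam G am b q.1 :=
      (measurable_pegeParam ho b).comp measurable_fst
    have h2 := (measurable_sum_gap_pegeAction hs ham h1 measurable_snd (b * G.s)
      (Finset.Ico (b * G.s) T)).ennreal_ofReal
    exact Measurable.ite (measurable_fst hEm) h2 measurable_const
  have hmem : ∀ ω, A ω ∈ E ↔ (fun i => θ i ω) ∈ E := fun ω =>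
    ⟨mem_foundSet_congr (hAeq ω), mem_foundSet_congr fun i hi => (hAeq ω i hi).symm⟩
  have hpar : ∀ ω, pegeParam G am b (A ω) = pegeParam G am b fun i => θ i ω := fun ω => by
    rw [pegeParam, pegeParam, avgEst_mul_congr (hAeq ω)]
  have hset : MeasurableSet {ω | (fun i => θ i ω) ∈ E} := (measurable_seq hθ) hEm
  calc _ = ∫⁻ ω, f (A ω) (B ω) ∂P := by
        refine lintegral_congr fun ω => ?_
        simp only [f, Set.indicator_apply, hmem ω, hpar ω, hFB]
        rfl
    _ = ∫⁻ ω, ∫⁻ ω', f (A ω) (B ω') ∂P ∂P := lintegral_indepFun hAm hBm hAB hfm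
    _ ≤ ∫⁻ ω, {ω | (fun i => θ i ω) ∈ E}.indicator (fun _ => ENNReal.ofReal K) ω ∂P := by
        refine lintegral_mono fun ω => ?_
        by_cases hω : A ω ∈ E
        · rw [Set.indicator_of_mem (s := {ω | (fun i => θ i ω) ∈ E}) ((hmem ω).1 hω)]
          simp only [f, hω, if_true, hFB]
          obtain ⟨h1, h2, h3, h4⟩ := hK _ hω
          exact (lintegral_pege_le hs hβ ham ho hgap hθ hp hind h1 h2 h3 _ hT).trans
            (ENNReal.ofReal_le_ofReal h4)
        · simp [f, hω]
    _ = _ := lintegral_indicator_const hset _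

theorem gapEpisodes_le_floor (am : Vec n → X) (τ δ : ℝ) (ϑ : ℕ → Vec n) :
    G.gapEpisodes am τ δ ϑ ≤ ⌊τ⌋₊ + 1 :=
  gapEpisodes_le (Nat.le_add_left _ _) (Or.inr (by exact_mod_cast Nat.lt_floor_add_one τ))

/-- A bound for the sum of the gaps along a path. -/
theorem sum_gap_le (ho : G.IsArgmaxOracle am) (hgap : ∀ x, G.gap x ≤ G.Rmax)
    (T : ℕ) (ϑ : ℕ → Vec n) :
    ∑ t ∈ Finset.range T, G.gap (G.pege2Action am T ϑ t) ≤
      G.gapEpisodes am (G.T₀ T) (1 / T) ϑ * G.s * G.Rmax +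
        ∑ t ∈ Finset.Ico (G.gapEpisodes am (G.T₀ T) (1 / T) ϑ * G.s) T,
          G.gap (commitAction G am T (G.gapEpisodes am (G.T₀ T) (1 / T) ϑ) ϑ t) := by
  set N := G.gapEpisodes am (G.T₀ T) (1 / T) ϑ with hN
  have h1 : ∀ m, ∑ t ∈ Finset.range m, G.gap (G.pege2Action am T ϑ t) ≤ m * G.Rmax := by
    intro m
    refine (Finset.sum_le_card_nsmul _ _ _ fun t _ => hgap _).trans ?_
    simp
  have hRm : 0 ≤ G.Rmax := (ho.gap_nonneg (am 0)).trans (hgap _)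
  rcases le_or_gt (N * G.s) T with h | h
  · rw [← Finset.sum_range_add_sum_Ico _ h]
    refine add_le_add (by exact_mod_cast h1 (N * G.s)) (le_of_eq (Finset.sum_congr rfl fun t ht => ?_))
    rw [pege2Action_of_le (Finset.mem_Ico.1 ht).1]
  · rw [Finset.Ico_eq_empty (by omega), Finset.sum_empty, add_zero]
    refine (h1 T).trans (mul_le_mul_of_nonneg_right ?_ hRm)
    exact_mod_cast h.le

/-- A bound for the regret of PEGE2 from deterministic bounds on its parts, valid as long as the
estimates are accurate. -/
theorem regret_le_of_parts [Nontrivial X] (hs : 0 < G.s) (hβ : 0 < G.betaσ)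
    (ham : Measurable am) (ho : G.IsArgmaxOracle am) (hgap : ∀ x, G.gap x ≤ G.Rmax)
    (hθ : ∀ t, Measurable (θ t)) (hp : ∀ t, P.map (θ t) = G.p) (hind : iIndepFun θ P) {T : ℕ}
    (hT : 1 ≤ T)
    (hint : ∀ t < T,
      Integrable (fun ω => G.r (G.pege2Action am T (fun i => θ i ω) t) (θ t ω)) P)
    {c K : ℝ} (hc : 0 ≤ c) (hK0 : 0 ≤ K)
    (hfound : ∀ ϑ, (∀ b, 1 ≤ b → b ≤ ⌊G.T₀ T⌋₊ + 1 → G.estError b ϑ < G.width (1 / T) b) →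
      G.GapFound am (1 / T) ϑ (G.gapEpisodes am (G.T₀ T) (1 / T) ϑ) →
      G.gapEpisodes am (G.T₀ T) (1 / T) ϑ * G.s * G.Rmax ≤ c)
    (hnot : ∀ ϑ, (∀ b, 1 ≤ b → b ≤ ⌊G.T₀ T⌋₊ + 1 → G.estError b ϑ < G.width (1 / T) b) →
      ¬ G.GapFound am (1 / T) ϑ (G.gapEpisodes am (G.T₀ T) (1 / T) ϑ) →
      G.gapEpisodes am (G.T₀ T) (1 / T) ϑ * G.s * G.Rmax +
        ∑ _t ∈ Finset.Ico (G.gapEpisodes am (G.T₀ T) (1 / T) ϑ * G.s) T,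
          2 * G.estError (G.gapEpisodes am (G.T₀ T) (1 / T) ϑ) ϑ ≤ c)
    (hK : ∀ b, 1 ≤ b → b ≤ ⌊G.T₀ T⌋₊ + 1 → ∀ ϑ ∈ foundSet G am T b,
      0 < G.minGap ∧ 0 < pegeParam G am b ϑ ∧
      pegeParam G am b ϑ ≤ G.minGap ^ 2 / (G.R ^ 2 * G.betaσ ^ 2) / 4 ∧
      (1 + Real.log T / pegeParam G am b ϑ) * G.blockGap +
        8 * G.Rmax / (G.minGap ^ 2 / (G.R ^ 2 * G.betaσ ^ 2)) ≤ K) :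
    G.regret am P θ T ≤ G.Rmax / 32 + c + K := by
  classical
  have hRm : 0 ≤ G.Rmax := (ho.gap_nonneg (am 0)).trans (hgap _)
  have hT' : (0 : ℝ) < T := by exact_mod_cast hT
  set M := ⌊G.T₀ T⌋₊ + 1 with hM
  refine regret_le_of_lintegral_le hs ham ho hgap hθ hp hind hint (by positivity) ?_
  set Bad := {ω | ∃ b, 1 ≤ b ∧ b ≤ M ∧ G.width (1 / T) b ≤ G.estError b fun i => θ i ω} with hBad
  have hBadm : MeasurableSet Bad := by
    have : Bad = ⋃ b : ℕ, {ω | 1 ≤ b ∧ b ≤ M ∧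
        G.width (1 / T) b ≤ G.estError b fun i => θ i ω} := by
      ext ω; simp [hBad]
    rw [this]
    refine MeasurableSet.iUnion fun b => (MeasurableSet.const _).inter ((MeasurableSet.const _).inter ?_)
    exact measurableSet_le measurable_const ((measurable_estError b).comp (measurable_seq hθ))
  let Q : ℕ → Ω → ENNReal := fun b ω => (foundSet G am T b).indicator
    (fun ϑ => ENNReal.ofReal (∑ t ∈ Finset.Ico (b * G.s) T,
        G.gap (G.pegeAction am (pegeParam G am b ϑ) (b * G.s) ϑ t))) (fun i => θ i ω)
  have hQm : ∀ b, Measurable (Q b) := by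
    intro b
    have h2 := (measurable_sum_gap_pegeAction (v := fun ϑ => ϑ) hs ham (measurable_pegeParam ho b)
      measurable_id (b * G.s) (Finset.Ico (b * G.s) T)).ennreal_ofReal
    exact (h2.indicator (measurableSet_foundSet ho T b)).comp (measurable_seq hθ)
  have hpath : ∀ ω, ENNReal.ofReal (∑ t ∈ Finset.range T,
      G.gap (G.pege2Action am T (fun i => θ i ω) t)) ≤
      Bad.indicator (fun _ => ENNReal.ofReal (T * G.Rmax)) ω +
        (ENNReal.ofReal c + ∑ b ∈ Finset.Icc 1 M, Q b ω) := by
    intro ω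
    set ϑ : ℕ → Vec n := fun i => θ i ω with hϑ
    by_cases hω : ω ∈ Bad
    · rw [Set.indicator_of_mem hω]
      refine le_add_right (ENNReal.ofReal_le_ofReal ?_)
      refine (Finset.sum_le_card_nsmul _ _ _ fun t _ => hgap _).trans ?_
      simp
    · rw [Set.indicator_of_notMem hω, zero_add]
      have hgood : ∀ b, 1 ≤ b → b ≤ M → G.estError b ϑ < G.width (1 / T) b := by
        intro b h1 h2
        by_contra! h3
        exact hω ⟨b, h1, h2, h3⟩
      have hN1 := (G.gapEpisodes_mem am (G.T₀ T) (1 / T) ϑ).1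
      have hN2 : G.gapEpisodes am (G.T₀ T) (1 / T) ϑ ≤ M := gapEpisodes_le_floor _ _ _ _
      refine (ENNReal.ofReal_le_ofReal (sum_gap_le ho hgap T ϑ)).trans ?_
      by_cases hf : G.GapFound am (1 / T) ϑ (G.gapEpisodes am (G.T₀ T) (1 / T) ϑ)
      · refine ENNReal.ofReal_add_le.trans
          (add_le_add (ENNReal.ofReal_le_ofReal (hfound ϑ hgood hf)) ?_)
        refine le_trans ?_ (Finset.single_le_sum (f := fun b => Q b ω) (fun _ _ => zero_le)
          (Finset.mem_Icc.2 ⟨hN1, hN2⟩))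
        have hmem : ϑ ∈ foundSet G am T (G.gapEpisodes am (G.T₀ T) (1 / T) ϑ) :=
          ⟨rfl, hf, hgood _ hN1 hN2⟩
        simp only [Q]
        rw [Set.indicator_of_mem hmem]
        refine ENNReal.ofReal_le_ofReal (le_of_eq (Finset.sum_congr rfl fun t _ => ?_))
        rw [commitAction, if_pos hf]
        rfl
      · refine le_add_right (ENNReal.ofReal_le_ofReal (le_trans ?_ (hnot ϑ hgood hf)))
        refine add_le_add_right (Finset.sum_le_sum fun t _ => ?_) _
        rw [commitAction, if_neg hf]
        exact ho.gap_argmax_le _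
  -- The episode count takes one value per path, so the PEGE cost `K` is charged only once in total.
  have hdisj : ∑ b ∈ Finset.Icc 1 M, P {ω | (fun i => θ i ω) ∈ foundSet G am T b} ≤ 1 := by
    rw [← measure_biUnion_finset]
    · exact prob_le_one
    · intro b _ b' _ hbb'
      refine Set.disjoint_left.2 fun ω h1 h2 => hbb' ?_
      exact h1.1.symm.trans h2.1
    · exact fun b _ => (measurable_seq hθ) (measurableSet_foundSet ho T b)
  calc _ ≤ ∫⁻ ω, Bad.indicator (fun _ => ENNReal.ofReal (T * G.Rmax)) ω +
        (ENNReal.ofReal c + ∑ b ∈ Finset.Icc 1 M, Q b ω) ∂P := lintegral_mono hpath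
    _ = ENNReal.ofReal (T * G.Rmax) * P Bad +
        (ENNReal.ofReal c + ∑ b ∈ Finset.Icc 1 M, ∫⁻ ω, Q b ω ∂P) := by
        rw [lintegral_add_left (measurable_const.indicator hBadm),
          lintegral_indicator_const hBadm, lintegral_add_left measurable_const, lintegral_const,
          measure_univ, mul_one, lintegral_finsetSum _ fun b _ => hQm b]
    _ ≤ ENNReal.ofReal (T * G.Rmax) * ENNReal.ofReal (1 / (32 * T)) +
        (ENNReal.ofReal c + ENNReal.ofReal K * 1) := by
        gcongr
        · exact measure_exists_width_le_le hβ hθ hp hind hT M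
        · refine (Finset.sum_le_sum fun b hb => ?_).trans
            ((Finset.mul_sum _ _ _).ge.trans (mul_le_mul_right hdisj _))
          obtain ⟨h1, h2⟩ := Finset.mem_Icc.1 hb
          exact lintegral_foundSet_le hs hβ ham ho hgap hθ hp hind hT (hK b h1 h2)
    _ = _ := by
        rw [mul_one, ← ENNReal.ofReal_mul (by positivity), ← ENNReal.ofReal_add hc hK0,
          ← ENNReal.ofReal_add (by positivity) (by positivity)]
        congr 1
        field_simp
        ring

end CPMGame
end

noncomputable section
namespace CPMGame

variable {n : ℕ} {X : Type*} [MeasurableSpace X] {G : CPMGame n X} {am : Vec n → X}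

/-! ### Bounds on the parts of the regret -/

/-- A real power of a negative base carries a factor cos(2π/3) < 0, and division by zero gives 0, so
T₀ ≥ 1 excludes every degenerate sign. -/
theorem pos_of_one_le_T₀ {T : ℕ} (h : 1 ≤ G.T₀ T) : 0 < G.s ∧ 0 < G.betaσ ∧ 0 < G.Rmax := by
  have hR := G.R_pos
  have hβ := G.betaσ_nonneg
  have hpos : 0 < 2 * G.R * G.betaσ * T / (G.s * G.Rmax) := by
    by_contra! hc
    rw [T₀] at h
    rcases hc.eq_or_lt with h0 | h0
    · rw [h0, Real.zero_rpow (by norm_num)] at h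
      linarith
    · rw [Real.rpow_def_of_neg h0] at h
      have hcos : Real.cos (2 / 3 * Real.pi) < 0 :=
        Real.cos_neg_of_pi_div_two_lt_of_lt (by linarith [Real.pi_pos]) (by linarith [Real.pi_pos])
      have := mul_neg_of_pos_of_neg
        (Real.exp_pos (Real.log (2 * G.R * G.betaσ * T / (G.s * G.Rmax)) * (2 / 3))) hcos
      linarith
  have hnum : 0 ≤ 2 * G.R * G.betaσ * T := by positivity
  have hs : 0 < G.s := by
    rcases G.s.eq_zero_or_pos with h0 | h0
    · rw [h0] at hpos; simp at hpos
    · exact h0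
  have hβ' : 0 < G.betaσ := by
    rcases hβ.eq_or_lt with h0 | h0
    · rw [← h0] at hpos; simp at hpos
    · exact h0
  refine ⟨hs, hβ', ?_⟩
  by_contra! hc
  have : 2 * G.R * G.betaσ * T / (G.s * G.Rmax) ≤ 0 :=
    div_nonpos_of_nonneg_of_nonpos hnum (mul_nonpos_of_nonneg_of_nonpos (Nat.cast_nonneg _) hc)
  linarith

/-- The balance defining T₀: the left side divided by √T₀ is, up to logarithms, the exploitation
loss, and it equals the cost of T₀ blocks. -/
theorem T₀_mul_sqrt {T : ℕ} (h : 1 ≤ G.T₀ T) :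
    2 * G.R * G.betaσ * T = G.s * G.Rmax * G.T₀ T * Real.sqrt (G.T₀ T) := by
  obtain ⟨hs, hβ, hRm⟩ := pos_of_one_le_T₀ h
  have hR := G.R_pos
  have hs' : (0 : ℝ) < G.s := by exact_mod_cast hs
  have hbase : 0 ≤ 2 * G.R * G.betaσ * T / (G.s * G.Rmax) := by positivity
  have h1 : G.T₀ T * Real.sqrt (G.T₀ T) = 2 * G.R * G.betaσ * T / (G.s * G.Rmax) := by
    have h2 : G.T₀ T * Real.sqrt (G.T₀ T) = G.T₀ T ^ (3 / 2 : ℝ) := by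
      rw [Real.sqrt_eq_rpow]
      nth_rw 1 [← Real.rpow_one (G.T₀ T)]
      rw [← Real.rpow_add (by linarith)]
      norm_num
    rw [h2, T₀, ← Real.rpow_mul hbase]
    norm_num
  rw [mul_assoc (G.s * G.Rmax), h1]
  field_simp

/-- The cost of gap estimation without success, and of the exploitation that follows. -/
theorem not_found_le {T : ℕ} (hT : 2 ≤ T) (hT₀ : 1 ≤ G.T₀ T)
    {ϑ : ℕ → Vec n}
    (hgood : ∀ b, 1 ≤ b → b ≤ ⌊G.T₀ T⌋₊ + 1 → G.estError b ϑ < G.width (1 / T) b)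
    (hf : ¬ G.GapFound am (1 / T) ϑ (G.gapEpisodes am (G.T₀ T) (1 / T) ϑ)) :
    G.gapEpisodes am (G.T₀ T) (1 / T) ϑ * G.s * G.Rmax +
        ∑ _t ∈ Finset.Ico (G.gapEpisodes am (G.T₀ T) (1 / T) ϑ * G.s) T,
          2 * G.estError (G.gapEpisodes am (G.T₀ T) (1 / T) ϑ) ϑ ≤
      2 * (G.T₀ T * G.s * G.Rmax) + G.T₀ T * G.s * G.Rmax *
        Real.sqrt (Real.log (4 * Real.exp 1 ^ 2 * (T : ℝ) ^ 3)) := by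
  obtain ⟨hs, hβ, hRm⟩ := pos_of_one_le_T₀ hT₀
  have hR := G.R_pos
  obtain ⟨hN1, hN⟩ := G.gapEpisodes_mem am (G.T₀ T) (1 / T) ϑ
  have hN2 : G.gapEpisodes am (G.T₀ T) (1 / T) ϑ ≤ ⌊G.T₀ T⌋₊ + 1 := gapEpisodes_le_floor _ _ _ _
  have hN3 := hN.resolve_left hf
  have herr := hgood _ hN1 hN2
  set N := G.gapEpisodes am (G.T₀ T) (1 / T) ϑ
  set S := Real.sqrt (Real.log (4 * Real.exp 1 ^ 2 * (T : ℝ) ^ 3)) with hS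
  have hT' : (2 : ℝ) ≤ T := by exact_mod_cast hT
  have hS0 : 2 ≤ S := (sqrt_log_cube_le hT').1
  have hN2' : (N : ℝ) ≤ 2 * G.T₀ T := by
    have h1 : (N : ℝ) ≤ ⌊G.T₀ T⌋₊ + 1 := by exact_mod_cast hN2
    have h2 : (⌊G.T₀ T⌋₊ : ℝ) ≤ G.T₀ T := Nat.floor_le (by linarith)
    linarith
  have hfirst : N * G.s * G.Rmax ≤ 2 * (G.T₀ T * G.s * G.Rmax) := by
    have h1 : (N : ℝ) * (G.s * G.Rmax) ≤ 2 * G.T₀ T * (G.s * G.Rmax) :=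
      mul_le_mul_of_nonneg_right hN2' (by positivity)
    linarith
  refine add_le_add hfirst ?_
  rcases le_or_gt T (N * G.s) with hlt | hlt
  · rw [Finset.Ico_eq_empty (by omega), Finset.sum_empty]
    positivity
  -- Exploitation occurs only if N ≤ T, which turns the logarithm in the width into that of 4e²T³.
  have hNT : N ≤ T := (Nat.le_mul_of_pos_right N hs).trans hlt.le
  have hNT' : (N : ℝ) ≤ T := by exact_mod_cast hNT
  have hN1' : (1 : ℝ) ≤ N := by exact_mod_cast hN1
  have hwS : G.width (1 / T) N ≤ G.R * G.betaσ * S / Real.sqrt (G.T₀ T) := by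
    refine abs_le_of_sq_le_sq' ?_ (by positivity) |>.2
    rw [width_sq (by omega) hN1, div_pow, Real.sq_sqrt (by linarith), mul_pow, mul_pow, hS,
      Real.sq_sqrt (Real.sqrt_pos.1 (by linarith)).le]
    have hlog : Real.log (4 * Real.exp 1 ^ 2 * (N : ℝ) ^ 2 * T) ≤
        Real.log (4 * Real.exp 1 ^ 2 * (T : ℝ) ^ 3) := by
      refine Real.log_le_log (by positivity) ?_
      have h1 : (N : ℝ) ^ 2 ≤ (T : ℝ) ^ 2 := by gcongr
      calc 4 * Real.exp 1 ^ 2 * (N : ℝ) ^ 2 * T ≤ 4 * Real.exp 1 ^ 2 * (T : ℝ) ^ 2 * T := by gcongr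
        _ = _ := by ring
    have hpos : 0 ≤ Real.log (4 * Real.exp 1 ^ 2 * (T : ℝ) ^ 3) :=
      (Real.sqrt_pos.1 (by linarith : (0 : ℝ) < S)).le
    gcongr
  have herr0 : 0 ≤ G.estError N ϑ := by rw [estError]; positivity
  have hsqrt : 0 < Real.sqrt (G.T₀ T) := Real.sqrt_pos.2 (by linarith)
  calc ∑ _t ∈ Finset.Ico (N * G.s) T, 2 * G.estError N ϑ
      = ((T - N * G.s : ℕ) : ℝ) * (2 * G.estError N ϑ) := by simp
    _ ≤ T * (2 * (G.R * G.betaσ * S / Real.sqrt (G.T₀ T))) := by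
        refine mul_le_mul (by exact_mod_cast Nat.sub_le _ _) ?_ (by positivity) (by positivity)
        linarith
    _ = 2 * G.R * G.betaσ * T * (S / Real.sqrt (G.T₀ T)) := by ring
    _ = _ := by
        rw [T₀_mul_sqrt hT₀]
        field_simp

theorem gapEpisodes_mul_le {T : ℕ} (hT₀ : 1 ≤ G.T₀ T) (ϑ : ℕ → Vec n) :
    G.gapEpisodes am (G.T₀ T) (1 / T) ϑ ≤ 2 * G.T₀ T := by
  have h1 : (G.gapEpisodes am (G.T₀ T) (1 / T) ϑ : ℝ) ≤ ⌊G.T₀ T⌋₊ + 1 := by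
    exact_mod_cast gapEpisodes_le_floor am (G.T₀ T) (1 / T) ϑ
  have h2 : (⌊G.T₀ T⌋₊ : ℝ) ≤ G.T₀ T := Nat.floor_le (by linarith)
  linarith

theorem not_gapFound (ho : G.IsArgmaxOracle am) (hu : ¬ G.UniqueOptimal) {δ : ℝ} {b : ℕ}
    {ϑ : ℕ → Vec n} (h : G.estError b ϑ < G.width δ b) : ¬ G.GapFound am δ ϑ b := by
  intro hf
  have h1 := ho.gapFound_iff.1 hf
  have h2 := ho.estGap_le_of_not_uniqueOptimal hu (G.avgEst ϑ (fun i => i * G.s) b)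
  have h3 := G.width_nonneg δ b
  rw [estError] at h
  linarith

variable (G) in
/-- The squared ratio of the gap to the scale of the estimation error. -/
def gapRatio : ℝ := G.minGap ^ 2 / (G.R ^ 2 * G.betaσ ^ 2)

/-- From estGap > 6w and |estGap - Δ| ≤ 2w follow Δ > 4w and 3Δ/4 ≤ estGap ≤ 3Δ/2; squaring and
dividing by 9 gives the factors 1/16 and 1/4. -/
theorem pegeParam_bounds [Nontrivial X] (ho : G.IsArgmaxOracle am) (hβ : 0 < G.betaσ)
    (hu : G.UniqueOptimal) (hΔ : 0 < G.minGap) {T b : ℕ} {ϑ : ℕ → Vec n}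
    (h : ϑ ∈ foundSet G am T b) :
    G.gapRatio / 16 ≤ pegeParam G am b ϑ ∧ pegeParam G am b ϑ ≤ G.gapRatio / 4 ∧
      4 * G.width (1 / T) b < G.minGap := by
  have hR := G.R_pos
  obtain ⟨_, hf, he⟩ := h
  have h1 := ho.gapFound_iff.1 hf
  rw [estError] at he
  rw [pegeParam, gapRatio]
  set v := G.avgEst ϑ (fun i => i * G.s) b
  have h2 := ho.minGap_sub_le_estGap hu v
  have h3 := ho.estGap_le_minGap_add hΔ v
  have hw := G.width_nonneg (1 / T) b
  have hden : 0 < G.R ^ 2 * G.betaσ ^ 2 := by positivity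
  refine ⟨?_, ?_, by linarith⟩
  · rw [div_div, div_le_div_iff₀ (by positivity) (by positivity)]
    have h4 : (3 / 4 * G.minGap) ^ 2 ≤ G.estGap am v ^ 2 :=
      pow_le_pow_left₀ (by positivity) (by linarith) 2
    nlinarith
  · rw [div_div, div_le_div_iff₀ (by positivity) (by positivity)]
    have h4 : G.estGap am v ^ 2 ≤ (3 / 2 * G.minGap) ^ 2 :=
      pow_le_pow_left₀ (by linarith) (by linarith) 2
    nlinarith

theorem peg_bound_le {L B h D Rm : ℝ} (hL : 0 ≤ L) (hB : 0 ≤ B) (hD : 0 < D) (h1 : D / 16 ≤ h) :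
    (1 + L / h) * B + 8 * Rm / D ≤ (1 + 16 * L / D) * B + 8 * Rm / D := by
  have h2 : L / h ≤ 16 * L / D := by
    rw [div_le_div_iff₀ (by linarith) hD]
    nlinarith
  have := mul_le_mul_of_nonneg_right h2 hB
  linarith

theorem gapFound_of_width_le [Nontrivial X] (ho : G.IsArgmaxOracle am) (hu : G.UniqueOptimal)
    {δ : ℝ} {b : ℕ} {ϑ : ℕ → Vec n} (hw : 8 * G.width δ b ≤ G.minGap)
    (h : G.estError b ϑ < G.width δ b) : G.GapFound am δ ϑ b := by
  rw [ho.gapFound_iff]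
  have h2 := ho.minGap_sub_le_estGap hu (G.avgEst ϑ (fun i => i * G.s) b)
  rw [estError] at h
  linarith

theorem T₁_eq (hβ : 0 < G.betaσ) (hΔ : 0 < G.minGap) {T : ℕ} (hT : 2 ≤ T) :
    G.T₁ (1 / T) =
      256 / G.gapRatio * Real.log (512 * Real.exp 1 ^ 2 * T / G.gapRatio) := by
  have hR := G.R_pos
  have hT' : (T : ℝ) ≠ 0 := by positivity
  rw [T₁, gapRatio]
  congr 1
  · field_simp
  · congr 1
    field_simp

theorem B₁_eq {T : ℕ} (hT₀ : 1 ≤ G.T₀ T) :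
    G.B₁ T = 2 * (G.T₀ T * G.s * G.Rmax) *
      Real.sqrt (Real.log (4 * Real.exp 1 ^ 2 * (T : ℝ) ^ 3)) + G.Rmax := by
  obtain ⟨hs, hβ, hRm⟩ := pos_of_one_le_T₀ hT₀
  have hR := G.R_pos
  have hs' : (0 : ℝ) < G.s := by exact_mod_cast hs
  set q := (G.s : ℝ) ^ (1 / 2 : ℝ) * G.Rmax ^ (1 / 2 : ℝ) with hq
  have hq0 : 0 < q := by positivity
  have hq2 : q ^ 2 = G.s * G.Rmax := by
    rw [hq, mul_pow, ← Real.rpow_natCast, ← Real.rpow_natCast, ← Real.rpow_mul hs'.le,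
      ← Real.rpow_mul hRm.le]
    norm_num
  have h1 : 2 * G.R * G.betaσ * (G.s : ℝ) ^ (1 / 2 : ℝ) * G.Rmax ^ (1 / 2 : ℝ) * T =
      2 * G.R * G.betaσ * T / (G.s * G.Rmax) * q ^ 3 := by
    rw [← hq2, mul_assoc (2 * G.R * G.betaσ), ← hq]
    field_simp
  have h2 : (2 * G.R * G.betaσ * (G.s : ℝ) ^ (1 / 2 : ℝ) * G.Rmax ^ (1 / 2 : ℝ) * T) ^
      (2 / 3 : ℝ) = G.T₀ T * (G.s * G.Rmax) := by
    rw [h1, Real.mul_rpow (by positivity) (by positivity), T₀, ← hq2, ← Real.rpow_natCast q 3,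
      ← Real.rpow_mul hq0.le, ← Real.rpow_natCast q 2]
    norm_num
  rw [B₁, h2]
  ring

/-! ### The three regret bounds -/

variable {Ω : Type*} [MeasurableSpace Ω] {P : Measure Ω} [IsProbabilityMeasure P]
  {θ : ℕ → Ω → Vec n}

/-- The distribution independent regret bound. -/
theorem regret_le_B₁ (ham : Measurable am)
    (ho : G.IsArgmaxOracle am) (hgap : ∀ x, G.gap x ≤ G.Rmax) (hθ : ∀ t, Measurable (θ t))
    (hp : ∀ t, P.map (θ t) = G.p) (hind : iIndepFun θ P) {T : ℕ} (hT : 2 ≤ T) (hT₀ : 1 ≤ G.T₀ T)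
    (hint : ∀ t < T,
      Integrable (fun ω => G.r (G.pege2Action am T (fun i => θ i ω) t) (θ t ω)) P)
    (hu : ¬ G.UniqueOptimal) : G.regret am P θ T ≤ G.B₁ T := by
  obtain ⟨hs, hβ, hRm⟩ := pos_of_one_le_T₀ hT₀
  have hT1 : 1 ≤ T := by omega
  have hT' : (2 : ℝ) ≤ T := by exact_mod_cast hT
  obtain ⟨hS2, hS8⟩ := sqrt_log_cube_le hT'
  set S := Real.sqrt (Real.log (4 * Real.exp 1 ^ 2 * (T : ℝ) ^ 3)) with hS
  set A := G.T₀ T * G.s * G.Rmax with hA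
  have hA0 : 0 ≤ A := by positivity
  have hnt : Nontrivial X := by
    by_contra hc
    rw [not_nontrivial_iff_subsingleton] at hc
    exact hu ⟨am 0, fun y => by rw [Subsingleton.elim y (am 0)], fun y _ => Subsingleton.elim _ _⟩
  -- Ties never let the test succeed on the good event, so PEGE contributes K = 0; and 2A ≤ AS
  -- because S ≥ 2.
  have key := regret_le_of_parts hs hβ ham ho hgap hθ hp hind hT1 hint
    (c := 2 * A + A * S) (K := 0) (by positivity) le_rfl
    (fun ϑ hgood hf => absurd hf (not_gapFound ho hu
      (hgood _ (G.gapEpisodes_mem am _ _ ϑ).1 (gapEpisodes_le_floor _ _ _ _))))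
    (fun ϑ hgood hf => not_found_le hT hT₀ hgood hf)
    (fun b _ _ ϑ hϑ => absurd hϑ.2.1 (not_gapFound ho hu hϑ.2.2))
  rw [B₁_eq hT₀]
  nlinarith

theorem nontrivial_of_minGap_pos (ho : G.IsArgmaxOracle am) (hΔ : 0 < G.minGap) : Nontrivial X := by
  by_contra hc
  rw [not_nontrivial_iff_subsingleton] at hc
  have hempty : {d | ∃ x, d = G.gap x ∧ 0 < G.gap x} = ∅ := by
    refine Set.eq_empty_iff_forall_notMem.2 ?_
    rintro _ ⟨x, rfl, hx⟩
    rw [ho.gap_eq, Subsingleton.elim x (am G.mean), sub_self] at hx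
    exact lt_irrefl _ hx
  rw [minGap, hempty, Real.sInf_empty] at hΔ
  exact lt_irrefl _ hΔ

/-- The distribution dependent regret bound. -/
theorem regret_le_B₂ (ham : Measurable am)
    (ho : G.IsArgmaxOracle am) (hgap : ∀ x, G.gap x ≤ G.Rmax) (hθ : ∀ t, Measurable (θ t))
    (hp : ∀ t, P.map (θ t) = G.p) (hind : iIndepFun θ P) {T : ℕ} (hT : 2 ≤ T) (hT₀ : 1 ≤ G.T₀ T)
    (hint : ∀ t < T,
      Integrable (fun ω => G.r (G.pege2Action am T (fun i => θ i ω) t) (θ t ω)) P)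
    (hu : G.UniqueOptimal) (hΔ : 0 < G.minGap) (hlt : G.T₁ (1 / T) < G.T₀ T) :
    G.regret am P θ T ≤ G.B₂ T := by
  obtain ⟨hs, hβ, hRm⟩ := pos_of_one_le_T₀ hT₀
  have hR := G.R_pos
  have hs' : (1 : ℝ) ≤ G.s := by exact_mod_cast hs
  have hT1 : 1 ≤ T := by omega
  have hT' : (2 : ℝ) ≤ T := by exact_mod_cast hT
  have hlogT0 : 0 ≤ Real.log T := Real.log_nonneg (by linarith)
  have hblock := ho.blockGap_nonneg
  have hblock' := blockGap_le (G := G) hgap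
  have hnt := nontrivial_of_minGap_pos ho hΔ
  have hD : 0 < G.gapRatio := by rw [gapRatio]; positivity
  obtain ⟨b, hb1, hbT, hbw, hbs⟩ := exists_episodes hT' hD (T₁_eq hβ hΔ hT)
  have hbT₀ : (b : ℝ) ≤ G.T₀ T := hbT.trans (max_le hlt.le hT₀)
  have hbM : b ≤ ⌊G.T₀ T⌋₊ + 1 := (Nat.le_floor hbT₀).trans (Nat.le_succ _)
  have hw8 : 8 * G.width (1 / T) b ≤ G.minGap := by
    have hb1' : (0 : ℝ) < b := by exact_mod_cast hb1
    refine (abs_le_of_sq_le_sq' ?_ hΔ.le).2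
    rw [mul_pow, width_sq hT1 hb1, mul_div_assoc', div_le_iff₀ hb1']
    have hmul := mul_le_mul_of_nonneg_left hbw
      (show 0 ≤ G.R ^ 2 * G.betaσ ^ 2 by positivity)
    have hD' : G.R ^ 2 * G.betaσ ^ 2 * G.gapRatio = G.minGap ^ 2 := by
      rw [gapRatio]; field_simp
    nlinarith
  have hNb : ∀ ϑ, (∀ b, 1 ≤ b → b ≤ ⌊G.T₀ T⌋₊ + 1 → G.estError b ϑ < G.width (1 / T) b) →
      G.gapEpisodes am (G.T₀ T) (1 / T) ϑ ≤ b := fun ϑ hgood =>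
    gapEpisodes_le hb1 (Or.inl (gapFound_of_width_le ho hu hw8 (hgood b hb1 hbM)))
  have key := regret_le_of_parts hs hβ ham ho hgap hθ hp hind hT1 hint
    (c := b * G.s * G.Rmax)
    (K := (1 + 16 * Real.log T / G.gapRatio) * G.blockGap + 8 * G.Rmax / G.gapRatio)
    (by positivity) (by positivity)
    (fun ϑ hgood _ => by
      have h1 : (G.gapEpisodes am (G.T₀ T) (1 / T) ϑ : ℝ) ≤ b := by
        exact_mod_cast hNb ϑ hgood
      gcongr)
    -- Vacuous: exceeding the threshold needs more than T₀ episodes, while the test succeeds by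
    -- episode b ≤ T₀.
    (fun ϑ hgood hf => by
      have h1 := (G.gapEpisodes_mem am (G.T₀ T) (1 / T) ϑ).2.resolve_left hf
      have h2 : (G.gapEpisodes am (G.T₀ T) (1 / T) ϑ : ℝ) ≤ b := by
        exact_mod_cast hNb ϑ hgood
      linarith)
    (fun b _ _ ϑ hϑ => by
      obtain ⟨h1, h2, _⟩ := pegeParam_bounds ho hβ hu hΔ hϑ
      exact ⟨hΔ, by linarith, h2, peg_bound_le hlogT0 hblock hD h1⟩)
  have hsum : ∑ k, G.gap (G.σ k) * (36 * G.R ^ 2 * G.betaσ ^ 2 * Real.log T / G.minGap ^ 2) =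
      36 * Real.log T / G.gapRatio * G.blockGap := by
    rw [← Finset.sum_mul, blockGap, gapRatio, mul_comm]
    congr 1
    field_simp
  rw [B₂, hsum]
  -- The term 8R_max/D is absorbed by the slack below T₁; the third summand of `B₂` lacks the factor
  -- R_max and cannot pay for it.
  have h3 := mul_le_mul_of_nonneg_right (hbs G.s hs') hRm.le
  have h4 : 16 * Real.log T / G.gapRatio * G.blockGap ≤
      36 * Real.log T / G.gapRatio * G.blockGap := by
    gcongr; norm_num
  have h5 : 0 ≤ 8 * Real.exp 1 ^ 2 * G.R ^ 2 * G.betaσ ^ 2 / G.minGap ^ 2 := by positivity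
  have h6 : 8 / G.gapRatio * G.Rmax = 8 * G.Rmax / G.gapRatio := by ring
  nlinarith

/-- A regret bound of order `T ^ (2 / 3) * log T`, whatever the gap. -/
theorem regret_le_rpow_mul_log (ham : Measurable am)
    (ho : G.IsArgmaxOracle am) (hgap : ∀ x, G.gap x ≤ G.Rmax) (hθ : ∀ t, Measurable (θ t))
    (hp : ∀ t, P.map (θ t) = G.p) (hind : iIndepFun θ P) {T : ℕ} (hT : 2 ≤ T) (hT₀ : 1 ≤ G.T₀ T)
    (hint : ∀ t < T,
      Integrable (fun ω => G.r (G.pege2Action am T (fun i => θ i ω) t) (θ t ω)) P)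
    (hu : G.UniqueOptimal) (hΔ : 0 < G.minGap) :
    G.regret am P θ T ≤
      (20 * ((2 * G.R * G.betaσ / (G.s * G.Rmax)) ^ (2 / 3 : ℝ) * G.s * G.Rmax) + G.Rmax) *
        ((T : ℝ) ^ (2 / 3 : ℝ) * Real.log T) := by
  obtain ⟨hs, hβ, hRm⟩ := pos_of_one_le_T₀ hT₀
  have hR := G.R_pos
  have hs' : (1 : ℝ) ≤ G.s := by exact_mod_cast hs
  have hT1 : 1 ≤ T := by omega
  have hT' : (2 : ℝ) ≤ T := by exact_mod_cast hT
  have hlogT0 : 0 ≤ Real.log T := Real.log_nonneg (by linarith)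
  obtain ⟨hS2, hS8⟩ := sqrt_log_cube_le hT'
  set S := Real.sqrt (Real.log (4 * Real.exp 1 ^ 2 * (T : ℝ) ^ 3)) with hS
  set A := G.T₀ T * G.s * G.Rmax with hA
  have hA0 : 0 ≤ A := by positivity
  have hblock := ho.blockGap_nonneg
  have hblock' := blockGap_le (G := G) hgap
  have hnt := nontrivial_of_minGap_pos ho hΔ
  have hD : 0 < G.gapRatio := by rw [gapRatio]; positivity
  have hN : ∀ ϑ, G.gapEpisodes am (G.T₀ T) (1 / T) ϑ * G.s * G.Rmax ≤ 2 * A := fun ϑ => by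
    have h1 := mul_le_mul_of_nonneg_right (gapEpisodes_mul_le (am := am) hT₀ ϑ)
      (show 0 ≤ G.s * G.Rmax by positivity)
    rw [hA]
    linarith
  have key := regret_le_of_parts hs hβ ham ho hgap hθ hp hind hT1 hint
    (c := 2 * A + A * S) (K := (1 + 2 * G.T₀ T) * G.blockGap + G.Rmax * G.T₀ T)
    (by positivity) (by positivity)
    (fun ϑ _ _ => (hN ϑ).trans (le_add_of_nonneg_right (by positivity)))
    (fun ϑ hgood hf => not_found_le hT hT₀ hgood hf)
    (fun b hb1 hbM ϑ hϑ => by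
      obtain ⟨h1, h2, h3⟩ := pegeParam_bounds ho hβ hu hΔ hϑ
      refine ⟨hΔ, by linarith, h2, (peg_bound_le hlogT0 hblock hD h1).trans ?_⟩
      have hb1' : (1 : ℝ) ≤ b := by exact_mod_cast hb1
      have hb2 : (b : ℝ) ≤ 2 * G.T₀ T := by
        have := gapEpisodes_mul_le (am := am) hT₀ ϑ
        rwa [hϑ.1] at this
      -- Success certifies a large gap: 4w(b) < Δ squared, with log(4e²b²T) ≥ log T + 2. Together
      -- with b ≤ 2T₀ this bounds both log T / D and 1/D by multiples of T₀.
      have h4 : 16 * (Real.log T + 2) ≤ b * G.gapRatio := by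
        have h5 := pow_le_pow_left₀
          (mul_nonneg (by norm_num) (G.width_nonneg (1 / T) b)) h3.le 2
        rw [mul_pow, width_sq hT1 hb1, mul_div_assoc', div_le_iff₀ (by linarith)] at h5
        have h6 : Real.log T + 2 ≤ Real.log (4 * Real.exp 1 ^ 2 * (b : ℝ) ^ 2 * T) := by
          have h7 : Real.log T + 2 = Real.log (Real.exp 1 ^ 2 * T) := by
            rw [Real.log_mul (by positivity) (by positivity), Real.log_pow, Real.log_exp]
            push_cast; ring
          rw [h7]
          refine Real.log_le_log (by positivity) ?_
          have h8 : (1 : ℝ) ≤ 4 * (b : ℝ) ^ 2 := by nlinarith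
          have h9 : 0 < Real.exp 1 ^ 2 * T := by positivity
          nlinarith
        have hD' : G.minGap ^ 2 = G.R ^ 2 * G.betaσ ^ 2 * G.gapRatio := by
          rw [gapRatio]; field_simp
        rw [hD'] at h5
        have hden : 0 < G.R ^ 2 * G.betaσ ^ 2 := by positivity
        have h10 : 16 * Real.log (4 * Real.exp 1 ^ 2 * (b : ℝ) ^ 2 * T) ≤ b * G.gapRatio := by
          refine le_of_mul_le_mul_left ?_ hden
          linarith
        linarith
      have h5 : 16 * Real.log T / G.gapRatio ≤ 2 * G.T₀ T := by
        rw [div_le_iff₀ hD]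
        nlinarith
      have h6 : 8 * G.Rmax / G.gapRatio ≤ G.Rmax * G.T₀ T := by
        rw [div_le_iff₀ hD, mul_comm 8, mul_assoc]
        refine mul_le_mul_of_nonneg_left ?_ hRm.le
        nlinarith
      have h7 := mul_le_mul_of_nonneg_right h5 hblock
      linarith)
  have hκ : G.T₀ T = (2 * G.R * G.betaσ / (G.s * G.Rmax)) ^ (2 / 3 : ℝ) *
      (T : ℝ) ^ (2 / 3 : ℝ) := by
    rw [T₀, ← Real.mul_rpow (by positivity) (by positivity)]
    congr 1
    ring
  have hTp : 1 ≤ (T : ℝ) ^ (2 / 3 : ℝ) := Real.one_le_rpow (by linarith) (by norm_num)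
  have hlog : 1 / 2 ≤ Real.log T := by
    have := Real.log_two_gt_d9
    have := Real.log_le_log (by norm_num) hT'
    linarith
  -- The costs add up to 2A + AS + 3A + A. With S ≤ 8 log T and 1 ≤ 2 log T this is at most (12 + 8)
  -- A log T, whence the 20.
  have hrhs : (20 * ((2 * G.R * G.betaσ / (G.s * G.Rmax)) ^ (2 / 3 : ℝ) * G.s * G.Rmax) +
      G.Rmax) * ((T : ℝ) ^ (2 / 3 : ℝ) * Real.log T) =
      20 * (A * Real.log T) + G.Rmax * ((T : ℝ) ^ (2 / 3 : ℝ) * Real.log T) := by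
    rw [hA, hκ]; ring
  rw [hrhs]
  have h1 : 1 / 2 ≤ (T : ℝ) ^ (2 / 3 : ℝ) * Real.log T := by nlinarith
  have h2 := mul_le_mul_of_nonneg_left h1 hRm.le
  have h3 := mul_le_mul_of_nonneg_left hS8 hA0
  have h4 := mul_le_mul_of_nonneg_left hlog hA0
  have h5 : (1 + 2 * G.T₀ T) * G.blockGap ≤ 3 * A := by
    have := mul_le_mul_of_nonneg_left hblock' (show 0 ≤ 1 + 2 * G.T₀ T by linarith)
    have h6 := mul_le_mul_of_nonneg_right hT₀ (show 0 ≤ G.s * G.Rmax by positivity)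
    rw [hA]
    linarith
  have h6 : G.Rmax * G.T₀ T ≤ A := by
    have := mul_le_mul_of_nonneg_left hs' (show 0 ≤ G.T₀ T * G.Rmax by positivity)
    rw [hA]
    linarith
  linarith

end CPMGame

end

theorem theorem4 :
    ∃ C : ℕ → ℝ → ℝ → ℝ → ℝ,
      ∀ (n : ℕ) (X : Type*) [MeasurableSpace X] (G : CPMGame n X)
        (am : Vec n → X) (_ : Measurable am) (_ : G.IsArgmaxOracle am)
        (_ : ∀ x, G.gap x ≤ G.Rmax)
        (Ω : Type*) [MeasurableSpace Ω] (P : Measure Ω) [IsProbabilityMeasure P]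
        (θ : ℕ → Ω → Vec n) (_ : ∀ t, Measurable (θ t)) (_ : ∀ t, P.map (θ t) = G.p)
        (_ : iIndepFun θ P)
        (T : ℕ) (_ : 2 ≤ T) (_ : 1 ≤ G.T₀ T)
        (_ : ∀ t < T,
          Integrable (fun ω => G.r (G.pege2Action am T (fun i => θ i ω) t) (θ t ω)) P),
        (¬ G.UniqueOptimal → G.regret am P θ T ≤ G.B₁ T) ∧
        (G.UniqueOptimal → 0 < G.minGap →
          (G.T₁ (1 / T) < G.T₀ T → G.regret am P θ T ≤ G.B₂ T) ∧
          (G.T₀ T ≤ G.T₁ (1 / T) →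
            G.regret am P θ T ≤
              C G.s G.R G.betaσ G.Rmax * ((T : ℝ) ^ (2 / 3 : ℝ) * Real.log T))) := by
  refine ⟨fun s R β Rm => 20 * ((2 * R * β / (s * Rm)) ^ (2 / 3 : ℝ) * s * Rm) + Rm, ?_⟩
  intro n X _ G am ham ho hgap Ω _ P _ θ hθ hp hind T hT hT₀ hint
  exact ⟨CPMGame.regret_le_B₁ ham ho hgap hθ hp hind hT hT₀ hint, fun hu hΔ =>
    ⟨CPMGame.regret_le_B₂ ham ho hgap hθ hp hind hT hT₀ hint hu hΔ,
      fun _ => CPMGame.regret_le_rpow_mul_log ham ho hgap hθ hp hind hT hT₀ hint hu hΔ⟩⟩
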